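/- \textbf{Model.} There are $m$ non-null outcomes; outcomes are $0,1,\dots,m$ in order of increasing requester value $v(\cdot)\in[0,1]$, where $0$ is the null outcome, $v(0)=0$. In each round the requester posts a contract $x$ (a payment $x(\pi)\ge 0$ for each outcome, $x(0)=0$, nondecreasing in $\pi$), identified with its vector of increments $x(\pi)-x(\pi-1)$, $1\le \pi\le m$. A worker arrives whose type $i$ is an independent sample from a fixed unknown distribution; type $i$ has a cost $c_i(e)$ and an outcome distribution $f_i(\cdot|e)$ for each effort level $e$; there is a null effort level of zero cost that leads to the null outcome with certainty and is the only one that can lead to it. The worker chooses $e$ to maximize $\sum_\pi f_i(\pi|e)x(\pi)-c_i(e)$, an outcome $\pi$ is drawn from $f_i(\cdot|e)$, and the requester observes only $\pi$ and gains $v(\pi)-x(\pi)$. Let $V(x)$, $P(x)$ and $U(x)=V(x)-P(x)$ be the expected value, payment and gain. Assume that for every type and any two distinct effort levels one has first-order stochastic dominance over the other, i.e. $\sum_{\pi'\ge\pi}f_i(\pi'|e)\ge\sum_{\pi'\ge\pi}f_i(\pi'|e')$ for all $\pi$, strictly for at least one $\pi$; and that ties are broken consistently: if two effort levels are both optimal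 for a worker under two contracts, the worker does not choose one of them under the first contract and the other under the second. Let $X_{\rm cand}\ne\emptyset$ be a set of monotone contracts with payments in $[0,1]$, let $\mathrm{OPT}=\sup_{x\in X_{\rm cand}}U(x)$ and $X_\varepsilon=\{x\in X_{\rm cand}:\mathrm{OPT}-U(x)\le\varepsilon\}$. A cell is a closed axis-aligned cube in the increment space $[0,1]^m$; it is relevant if it contains a candidate contract, composite if it contains more than one, atomic if exactly one. The anchors of a composite cell $C$ are its maximal and minimal corners $x^+,x^-$; the anchor of an atomic cell is its candidate contract. The virtual width of $C$ is $\mathrm{VW}(C)=(V(x^+)-P(x^-))-(V(x^-)-P(x^+))$. The quadrants of $C$ are its $2^m$ subcubes of half the side having the center of $C$ as a corner. Feasible cells are $[0,1]^m$ and, recursively, all relevant quadrants of feasible cells. $N_\varepsilon(Y)$ is the number of feasible composite cells $C$ with $\mathrm{VW}(C)\ge\varepsilon$ and $C\cap Y\neq\emptyset$. \textbf{Algorithm (Agnostic Zooming, horizon $T$, confidence constant $c$).} The active collection starts as $\{[0,1]^m\}$. In round $t$ choose an active cell $C_t$ of maximal index $I_t$ (ties broken arbitrarily) and post a uniformly random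 anchor of $C_t$. Here $n_t(C)$ is the number of earlier rounds in which $C$ was chosen, $\mathrm{rad}_t(C)=\sqrt{c\log T/n_t(C)}$ ($=\infty$ if $n_t(C)=0$), $U_t(C)$ is the average gain over these rounds, $W_t(C)=(V_t^+-P_t^-)-(V_t^--P_t^+)$, where $V_t^\pm,P_t^\pm$ are the average value and payment over those of these rounds in which $x^\pm$ was posted (an empty average is $0$), and $I_t(C)=U_t(C)+\mathrm{rad}_t(C)$ if $C$ is atomic, $I_t(C)=U_t(C)+W_t(C)+5\,\mathrm{rad}_t(C)$ if $C$ is composite. After the round, if $C_t$ is composite and $W_{t+1}(C_t)>5\,\mathrm{rad}_{t+1}(C_t)$, replace $C_t$ in the active collection by its relevant quadrants. The regret is $R(T|X_{\rm cand})=T\cdot\mathrm{OPT}-\mathbb E[\text{total gain in }T\text{ rounds}]$. \textbf{Statement.} There is an absolute constant $\beta_0>0$ such that for every $m$ and every $c\ge 16m^2$ there is a constant $K=K(m,c)$ for which the following holds. For every instance and candidate set as above, every $T\ge\max(2^m+1,18)$ and every $\alpha>0$, let $$d=\inf\{d\ge 0:\ N_{\varepsilon\beta_0}(X_\varepsilon)\le\alpha\,\varepsilon^{-d}\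 \text{ for all }\varepsilon>0\}\in[0,\infty]$$ be the width dimension. Then $$R(T|X_{\rm cand})\ \le\ K\,\max(1,\alpha\log T)\;T^{(1+d)/(2+d)},$$ where the exponent is $1$ if $d=\infty$. In particular, $R(T|X_{\rm cand})\le K\,\alpha\log T\cdot T^{(1+d)/(2+d)}$ whenever $\alpha\log T\ge1$. -/

import Mathlib

open scoped ENNReal NNReal

universe u v

noncomputable section

namespace AgnosticZooming

/-! ## Contracts

Outcomes are `Fin (m + 1)`, in the order of increasing value, with `0` the null outcome. A monotone
contract is given by its increment vector `x : Fin m → ℝ`, where `x j` is the payment for outcome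
`j + 1` minus the payment for outcome `j`; the payment for the null outcome is zero. -/

/-- The payment of the contract with increments `x` for outcome `o`. -/
def pay {m : ℕ} (x : Fin m → ℝ) (o : Fin (m + 1)) : ℝ :=
  ∑ j : Fin m, if j.castSucc < o then x j else 0

/-- Weakly bounded contracts: the unit cube of increments. -/
def weaklyBounded (m : ℕ) : Set (Fin m → ℝ) := {x | ∀ j, 0 ≤ x j ∧ x j ≤ 1}

/-- Bounded, monotone contracts: nonnegative increments and all payments in `[0,1]`. -/
def boundedMonotone (m : ℕ) : Set (Fin m → ℝ) :=
  {x | (∀ j, 0 ≤ x j) ∧ ∀ o, 0 ≤ pay x o ∧ pay x o ≤ 1}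

/-! ## Problem instances -/

/-- An instance of dynamic contract design with `m` non-null outcomes, effort levels `E` and worker
types `Θ`. -/
structure Market (m : ℕ) (E : Type u) (Θ : Type v) [MeasurableSpace Θ] where
  /-- the value function of the requester -/
  value : Fin (m + 1) → ℝ
  value_zero : value 0 = 0
  value_mono : Monotone value
  value_le_one : ∀ o, value o ≤ 1
  /-- the null effort level -/
  nullEffort : E
  /-- the cost function of each type -/
  cost : Θ → E → ℝ
  /-- the production function of each type -/
  production : Θ → E → PMF (Fin (m + 1))
  cost_null : ∀ θ, cost θ nullEffort = 0
  production_null : ∀ θ, production θ nullEffort = PMF.pure 0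
  production_zero : ∀ θ e, e ≠ nullEffort → production θ e 0 = 0
  /-- the supply distribution -/
  supply : MeasureTheory.Measure Θ
  supply_prob : MeasureTheory.IsProbabilityMeasure supply
  /-- the effort level that a worker of a given type chooses under a given contract -/
  choice : Θ → (Fin m → ℝ) → E
  /-- workers maximize their expected payment minus cost -/
  choice_optimal : ∀ θ, ∀ x ∈ weaklyBounded m, ∀ e,
    ∑ o, (production θ e o).toReal * pay x o - cost θ e ≤
      ∑ o, (production θ (choice θ x) o).toReal * pay x o - cost θ (choice θ x)
  choice_measurable : ∀ x o, Measurable fun θ => production θ (choice θ x) o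

namespace Market

variable {m : ℕ} {E : Type u} {Θ : Type v} [MeasurableSpace Θ] (M : Market m E Θ)

/-- Expected utility of a worker of type `θ` who exerts effort `e` under the contract `x`. -/
def workerUtility (θ : Θ) (x : Fin m → ℝ) (e : E) : ℝ :=
  ∑ o, (M.production θ e o).toReal * pay x o - M.cost θ e

/-- `e` is an optimal effort level for type `θ` under the contract `x`. -/
def IsOptimal (θ : Θ) (x : Fin m → ℝ) (e : E) : Prop :=
  ∀ e', M.workerUtility θ x e' ≤ M.workerUtility θ x e

/-- The probability `F_θ(o | e)` of an outcome at least `o`. -/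
def upperProb (θ : Θ) (e : E) (o : Fin (m + 1)) : ℝ :=
  ∑ o' ∈ Finset.univ.filter (fun o' => o ≤ o'), (M.production θ e o').toReal

/-- For type `θ`, `e` has first-order stochastic dominance over `e'`. -/
def Dominates (θ : Θ) (e e' : E) : Prop :=
  (∀ o, M.upperProb θ e' o ≤ M.upperProb θ e o) ∧ ∃ o, M.upperProb θ e' o < M.upperProb θ e o

/-- All types satisfy the FOSD assumption. -/
def FOSD : Prop :=
  ∀ θ e e', e ≠ e' → M.Dominates θ e e' ∨ M.Dominates θ e' e

/-- Consistent tie-breaking: if the effort levels chosen under `x` and under `y` are tied for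
optimal under both contracts, the worker does not break this tie in two different ways. -/
def ConsistentTies : Prop :=
  ∀ θ, ∀ x ∈ weaklyBounded m, ∀ y ∈ weaklyBounded m,
    M.IsOptimal θ x (M.choice θ y) → M.IsOptimal θ y (M.choice θ x) → M.choice θ x = M.choice θ y

/-- The law of the outcome when contract `x` is offered to a worker drawn from the supply
distribution. -/
def outcomeLaw (x : Fin m → ℝ) : PMF (Fin (m + 1)) :=
  PMF.ofFintype (fun o => ∫⁻ θ, M.production θ (M.choice θ x) o ∂M.supply) (by
    have := M.supply_prob
    rw [← MeasureTheory.lintegral_finsetSum _ (fun o _ => M.choice_measurable x o)]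
    have h : ∀ θ, ∑ o, M.production θ (M.choice θ x) o = 1 := fun θ => by
      rw [← tsum_fintype (L := .unconditional _), PMF.tsum_coe]
    simp [h])

/-- Expected value `V(x)`. -/
def expValue (x : Fin m → ℝ) : ℝ := ∑ o, (M.outcomeLaw x o).toReal * M.value o

/-- Expected payment `P(x)`. -/
def expPay (x : Fin m → ℝ) : ℝ := ∑ o, (M.outcomeLaw x o).toReal * pay x o

/-- Expected utility `U(x)` of the requester. -/
def utility (x : Fin m → ℝ) : ℝ := M.expValue x - M.expPay x

/-- `OPT(X_cand)`. -/
def opt (Xc : Set (Fin m → ℝ)) : ℝ := sSup (M.utility '' Xc)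

/-- The set `X_ε` of candidate contracts of badness at most `ε`. -/
def nearOptimal (Xc : Set (Fin m → ℝ)) (ε : ℝ) : Set (Fin m → ℝ) :=
  {x | x ∈ Xc ∧ M.opt Xc - M.utility x ≤ ε}

end Market

/-! ## Cells -/

/-- A closed axis-aligned cube, by its minimal corner and its side length. -/
@[ext]
structure Cell (m : ℕ) where
  lo : Fin m → ℝ
  side : ℝ

namespace Cell

variable {m : ℕ}

/-- The maximal corner. -/
def hi (C : Cell m) : Fin m → ℝ := fun j => C.lo j + C.side

/-- The points of the cube. -/
def toSet (C : Cell m) : Set (Fin m → ℝ) := Set.Icc C.lo C.hi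

/-- The increment space `[0,1]^m`. -/
def root (m : ℕ) : Cell m := ⟨fun _ => 0, 1⟩

/-- The `2^m` quadrants. -/
def quadrants (C : Cell m) : Set (Cell m) :=
  Set.range fun s : Fin m → Bool => ⟨fun j => C.lo j + (if s j then C.side / 2 else 0), C.side / 2⟩

/-- The cell contains a candidate contract. -/
def Relevant (Xc : Set (Fin m → ℝ)) (C : Cell m) : Prop := (C.toSet ∩ Xc).Nonempty

/-- The cell contains more than one candidate contract. A relevant cell that is not composite is
atomic. -/
def Composite (Xc : Set (Fin m → ℝ)) (C : Cell m) : Prop := (C.toSet ∩ Xc).Nontrivial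

/-- Feasible cells. -/
inductive Feasible (Xc : Set (Fin m → ℝ)) : Cell m → Prop
  | root : Feasible Xc (root m)
  | quadrant {C Q : Cell m} :
      Feasible Xc C → Q ∈ C.quadrants → Q.Relevant Xc → Feasible Xc Q

open Classical in
/-- The uniform distribution on the anchors: the two corners of a composite cell, the unique
candidate contract of an atomic one. -/
def anchorLaw (Xc : Set (Fin m → ℝ)) (C : Cell m) : PMF (Fin m → ℝ) :=
  if C.Composite Xc then
    (PMF.uniformOfFintype Bool).map fun b => if b then C.hi else C.lo
  else PMF.pure (Classical.epsilon fun x => x ∈ C.toSet ∩ Xc)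

end Cell

/-! ## Width dimension -/

namespace Market

variable {m : ℕ} {E : Type u} {Θ : Type v} [MeasurableSpace Θ] (M : Market m E Θ)

/-- Virtual width of a cell. -/
def virtualWidth (C : Cell m) : ℝ :=
  (M.expValue C.hi - M.expPay C.lo) - (M.expValue C.lo - M.expPay C.hi)

/-- `N_ε(Y | X_cand)`: the number of feasible composite cells of virtual width at least `ε` that
overlap with `Y`. -/
def wideCount (Xc : Set (Fin m → ℝ)) (ε : ℝ) (Y : Set (Fin m → ℝ)) : ℕ∞ :=
  {C : Cell m | Cell.Feasible Xc C ∧ C.Composite Xc ∧ ε ≤ M.virtualWidth C ∧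
    (C.toSet ∩ Y).Nonempty}.encard

/-- The width dimension with multiplier `α` and slack constant `β`, that is
`inf {d ≥ 0 : N_{β ε}(X_ε | X_cand) ≤ α ε^{-d} for all ε > 0}`; it is `∞` if there is no such `d`. -/
def widthDim (Xc : Set (Fin m → ℝ)) (β α : ℝ) : ℝ≥0∞ :=
  ⨅ d ∈ {d : ℝ≥0 | ∀ ε : ℝ, 0 < ε →
    (M.wideCount Xc (ε * β) (M.nearOptimal Xc ε) : ℝ≥0∞) ≤
      ENNReal.ofReal (α * ε ^ (-(d : ℝ)))}, (d : ℝ≥0∞)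

end Market

/-- The exponent `(1 + d) / (2 + d)`, with limit value `1` at `d = ∞`. -/
def regretExponent (d : ℝ≥0∞) : ℝ :=
  if d = ⊤ then 1 else (1 + d.toReal) / (2 + d.toReal)

/-! ## The algorithm

It knows the value function `val`, the candidate set `Xc`, the constant `c` of the confidence radius
and the horizon `T`. -/

/-- What the requester sees in one round: the chosen cell, the posted contract and the outcome. -/
structure Round (m : ℕ) where
  cell : Cell m
  contract : Fin m → ℝ
  outcome : Fin (m + 1)

section Algorithm

open Classical

variable {m : ℕ}

/-- Average of `g` over a list of rounds (zero if the list is empty). -/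
def avg (l : List (Round m)) (g : Round m → ℝ) : ℝ := (l.map g).sum / (l.length : ℝ)

/-- The past rounds in which `C` was chosen. Histories list the most recent round first. -/
def plays (h : List (Round m)) (C : Cell m) : List (Round m) :=
  h.filter fun r => r.cell = C

/-- The past rounds in which `C` was chosen and the contract `x` was posted. -/
def playsWith (h : List (Round m)) (C : Cell m) (x : Fin m → ℝ) : List (Round m) :=
  h.filter fun r => r.cell = C ∧ r.contract = x

/-- The realized utility of the requester in a round. -/
def Round.gain (val : Fin (m + 1) → ℝ) (r : Round m) : ℝ :=
  val r.outcome - pay r.contract r.outcome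

/-- The estimate `U_t(C)`. -/
def estUtility (val : Fin (m + 1) → ℝ) (h : List (Round m)) (C : Cell m) : ℝ :=
  avg (plays h C) (Round.gain val)

/-- The estimate `W_t(C) = (V⁺ - P⁻) - (V⁻ - P⁺)` of the virtual width of a composite cell. -/
def estWidth (val : Fin (m + 1) → ℝ) (h : List (Round m)) (C : Cell m) : ℝ :=
  (avg (playsWith h C C.hi) (fun r => val r.outcome) -
      avg (playsWith h C C.lo) (fun r => pay r.contract r.outcome)) -
    (avg (playsWith h C C.lo) (fun r => val r.outcome) -
      avg (playsWith h C C.hi) (fun r => pay r.contract r.outcome))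

/-- The confidence radius of a cell that was chosen at least once. -/
def radius (c : ℝ) (T : ℕ) (h : List (Round m)) (C : Cell m) : ℝ :=
  Real.sqrt (c * Real.log T / ((plays h C).length : ℝ))

/-- The index; it is infinite for a cell that has not been chosen yet, as is its confidence
radius. -/
def index (val : Fin (m + 1) → ℝ) (Xc : Set (Fin m → ℝ)) (c : ℝ) (T : ℕ)
    (h : List (Round m)) (C : Cell m) : EReal :=
  if (plays h C).length = 0 then ⊤
  else if C.Composite Xc then
    ((estUtility val h C + estWidth val h C + 5 * radius c T h C : ℝ) : EReal)
  else ((estUtility val h C + radius c T h C : ℝ) : EReal)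

/-- The collection of active cells after the rounds in the history: after each round, a composite
chosen cell whose estimated width exceeds five confidence radii is replaced by its relevant
quadrants. -/
def active (val : Fin (m + 1) → ℝ) (Xc : Set (Fin m → ℝ)) (c : ℝ) (T : ℕ) :
    List (Round m) → Set (Cell m)
  | [] => {Cell.root m}
  | r :: h =>
    if r.cell.Composite Xc ∧ 5 * radius c T (r :: h) r.cell < estWidth val (r :: h) r.cell then
      (active val Xc c T h ∪ {Q | Q ∈ r.cell.quadrants ∧ Q.Relevant Xc}) \ {r.cell}
    else active val Xc c T h

/-- `select` picks, after each history, an active cell of maximal index (ties broken arbitrarily). -/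
def IsSelectionRule (val : Fin (m + 1) → ℝ) (Xc : Set (Fin m → ℝ)) (c : ℝ) (T : ℕ)
    (select : List (Round m) → Cell m) : Prop :=
  ∀ h, select h ∈ active val Xc c T h ∧
    ∀ C ∈ active val Xc c T h, index val Xc c T h C ≤ index val Xc c T h (select h)

end Algorithm

namespace Market

variable {m : ℕ} {E : Type u} {Θ : Type v} [MeasurableSpace Θ] (M : Market m E Θ)

/-- The law of the history after a number of rounds, when cells are chosen by `select`, the posted
contract is a uniformly random anchor of the chosen cell, and the worker of each round is drawn
independently from the supply distribution. -/
def historyLaw (Xc : Set (Fin m → ℝ)) (select : List (Round m) → Cell m) :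
    ℕ → PMF (List (Round m))
  | 0 => PMF.pure []
  | n + 1 => (historyLaw Xc select n).bind fun h =>
      ((select h).anchorLaw Xc).bind fun x =>
        (M.outcomeLaw x).map fun o => ⟨select h, x, o⟩ :: h

/-- Expected cumulative utility over `T` rounds (the law of the history has finite support). -/
def expTotalUtility (Xc : Set (Fin m → ℝ)) (select : List (Round m) → Cell m) (T : ℕ) : ℝ :=
  ∑' h, (M.historyLaw Xc select T h).toReal * (h.map (Round.gain M.value)).sum

/-- The regret `R(T | X_cand)`. -/
def regret (Xc : Set (Fin m → ℝ)) (select : List (Round m) → Cell m) (T : ℕ) : ℝ :=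
  T * M.opt Xc - M.expTotalUtility Xc select T

end Market

end AgnosticZooming

end

/-!
Agnostic zooming has regret governed by the width dimension.

*Structure of a cell.* Raising the increments of a contract moves each worker to an effort level
that dominates the old one: revealed preference rules out the opposite, and consistent tie-breaking
handles the tie (`Market.upperProb_choice_mono`). Hence expected value and expected payment are
monotone in the increments, all utilities in a cell lie in an interval whose length is the virtual
width, and the width of a subcell is at most that of the cell.

*Concentration.* In a round only the chosen cell changes its statistics. The sum over all cells
chosen so far of Hoeffding's exponential supermartingale therefore grows in mean by at most one per
round (`Market.histMean_potential_le`), and Markov's inequality bounds the probability that any of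
the randomly generated cells deviates, without a union over cells. With `c ≥ 16 m ^ 2` the
estimates of all chosen cells are within their confidence radii at all times, except with
probability `8 / T` (`Setting.histProb_not_clean_le`); the exception costs a constant.

*Clean histories.* Active cells cover the candidates and indices are optimistic, so the index of the
chosen cell is at least the optimum. As an active composite cell has not met the zooming condition,
its regret per round and its virtual width are at most eleven confidence radii
(`Setting.badness_le_radius`). So a cell whose larger of the two, its *badness*, is `w` is chosen at
most of the order of `c log T / w ^ 2` times, and costs of the order of `c log T / w`. A zoomed cell
has virtual width at least the confidence radius (`Setting.regret_le_of_zoomed`). Therefore a chosen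
cell of badness in `[r, 2r)` is a quadrant of a composite cell of virtual width at least `r / 17`
that contains a candidate of regret at most `4 r`, or is such a cell itself if it is the root; the
definition of the width dimension `d` with slack `1 / 68` bounds their number by
`(2 ^ m + 1) α r ^ (-d)` (`Setting.card_le_of_wideCount_le`). Cells of badness below `δ` cost `δ T`
in total; dyadic summation over the others gives the order of `α log T δ ^ (-1 - d)`, and
`δ = T ^ (-1 / (2 + d))` balances the two terms.
-/

noncomputable section

namespace AgnosticZooming

/-! ### Monotonicity of value and payment under stochastic dominance -/

lemma pay_zero {m : ℕ} (x : Fin m → ℝ) : pay x 0 = 0 := by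
  simp [pay]

lemma pay_succ {m : ℕ} (x : Fin m → ℝ) (j : Fin m) :
    pay x j.succ = pay x j.castSucc + x j := by
  have h : ∀ i : Fin m, (if i.castSucc < j.succ then x i else 0) =
      (if i.castSucc < j.castSucc then x i else 0) + (if i = j then x i else 0) := by
    intro i
    rcases lt_trichotomy i j with h | h | h
    · rw [if_pos (Fin.castSucc_lt_succ_iff.2 h.le), if_pos (Fin.castSucc_lt_castSucc_iff.2 h),
        if_neg h.ne, add_zero]
    · subst h
      simp
    · rw [if_neg (fun h' => absurd (Fin.castSucc_lt_succ_iff.1 h') (not_le.2 h)),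
        if_neg (fun h' => absurd (Fin.castSucc_lt_castSucc_iff.1 h') (not_lt.2 h.le)),
        if_neg h.ne', add_zero]
  unfold pay
  rw [Finset.sum_congr rfl fun i _ => h i, Finset.sum_add_distrib]
  simp

lemma pay_nonneg {m : ℕ} {x : Fin m → ℝ} (hx : x ∈ weaklyBounded m) (o : Fin (m + 1)) :
    0 ≤ pay x o :=
  Finset.sum_nonneg fun j _ => by split_ifs <;> [exact (hx j).1; exact le_rfl]

lemma pay_le {m : ℕ} {x : Fin m → ℝ} (hx : x ∈ weaklyBounded m) (o : Fin (m + 1)) :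
    pay x o ≤ m := by
  calc pay x o ≤ ∑ _j : Fin m, (1 : ℝ) :=
        Finset.sum_le_sum fun j _ => by split_ifs <;> [exact (hx j).2; exact zero_le_one]
    _ = m := by simp

/-- Summation by parts: the mean payment is the sum of the increments, each weighted with the
probability of an outcome above it. -/
lemma sum_mul_pay {m : ℕ} (p : Fin (m + 1) → ℝ) (x : Fin m → ℝ) :
    ∑ o, p o * pay x o =
      ∑ j, x j * ∑ o ∈ Finset.univ.filter (fun o => j.succ ≤ o), p o := by
  unfold pay
  simp_rw [Finset.mul_sum]
  rw [Finset.sum_comm]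
  refine Finset.sum_congr rfl fun j _ => ?_
  rw [Finset.sum_filter]
  refine Finset.sum_congr rfl fun o _ => ?_
  by_cases h : j.castSucc < o
  · rw [if_pos h, if_pos (Fin.castSucc_lt_iff_succ_le.1 h), mul_comm]
  · rw [if_neg h, if_neg (fun h' => h (Fin.castSucc_lt_iff_succ_le.2 h')), mul_zero]

lemma boundedMonotone_subset {m : ℕ} : boundedMonotone m ⊆ weaklyBounded m := by
  intro x hx j
  refine ⟨hx.1 j, le_trans ?_ (hx.2 j.succ).2⟩
  rw [pay_succ]
  have := (hx.2 j.castSucc).1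
  linarith

namespace Market

variable {m : ℕ} {E : Type u} {Θ : Type v} [MeasurableSpace Θ] (M : Market m E Θ)

lemma value_nonneg (o : Fin (m + 1)) : 0 ≤ M.value o := by
  rw [← M.value_zero]
  exact M.value_mono (Fin.zero_le o)

/-- The value function is itself the payment function of a contract. -/
lemma value_eq_pay (o : Fin (m + 1)) :
    M.value o = pay (fun j => M.value j.succ - M.value j.castSucc) o := by
  induction o using Fin.induction with
  | zero => rw [pay_zero, M.value_zero]
  | succ j ih => rw [pay_succ, ← ih]; ring

lemma workerUtility_eq (θ : Θ) (x : Fin m → ℝ) (e : E) :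
    M.workerUtility θ x e = ∑ j, x j * M.upperProb θ e j.succ - M.cost θ e := by
  unfold workerUtility upperProb
  rw [sum_mul_pay]

/-- Raising the increments of a contract moves every worker to an effort level that is at least as
productive: by revealed preference the new effort level cannot be dominated by the old one, unless
both are tied under both contracts, and then consistent tie-breaking makes them equal. -/
lemma upperProb_choice_mono (hF : M.FOSD) (hT : M.ConsistentTies) {x y : Fin m → ℝ}
    (hx : x ∈ weaklyBounded m) (hy : y ∈ weaklyBounded m) (hxy : x ≤ y) (θ : Θ)
    (o : Fin (m + 1)) :
    M.upperProb θ (M.choice θ x) o ≤ M.upperProb θ (M.choice θ y) o := by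
  by_cases heq : M.choice θ x = M.choice θ y
  · rw [heq]
  rcases hF θ _ _ heq with h | h
  · exfalso
    have ox : M.IsOptimal θ x (M.choice θ x) := fun e => M.choice_optimal θ x hx e
    have oy : M.IsOptimal θ y (M.choice θ y) := fun e => M.choice_optimal θ y hy e
    have h1 := ox (M.choice θ y)
    have h2 := oy (M.choice θ x)
    have h3 : ∑ j, (y j - x j) * (M.upperProb θ (M.choice θ y) j.succ -
        M.upperProb θ (M.choice θ x) j.succ) ≤ 0 :=
      Finset.sum_nonpos fun j _ => mul_nonpos_of_nonneg_of_nonpos (sub_nonneg.2 (hxy j))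
        (sub_nonpos.2 (h.1 _))
    have h4 : ∑ j, (y j - x j) * (M.upperProb θ (M.choice θ y) j.succ -
        M.upperProb θ (M.choice θ x) j.succ) =
        (M.workerUtility θ y (M.choice θ y) - M.workerUtility θ y (M.choice θ x)) +
        (M.workerUtility θ x (M.choice θ x) - M.workerUtility θ x (M.choice θ y)) := by
      simp only [workerUtility_eq]
      have : ∀ j, (y j - x j) * (M.upperProb θ (M.choice θ y) j.succ -
          M.upperProb θ (M.choice θ x) j.succ) =
          (y j * M.upperProb θ (M.choice θ y) j.succ - y j * M.upperProb θ (M.choice θ x) j.succ) +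
          (x j * M.upperProb θ (M.choice θ x) j.succ -
            x j * M.upperProb θ (M.choice θ y) j.succ) := fun j => by ring
      simp only [this, Finset.sum_add_distrib, Finset.sum_sub_distrib]
      ring
    refine heq (hT θ x hx y hy (fun e => (ox e).trans ?_) fun e => (oy e).trans ?_) <;> linarith
  · exact h.1 o

/-- The probability of an outcome at least `o` under the contract `x`. -/
def tailProb (x : Fin m → ℝ) (o : Fin (m + 1)) : ℝ :=
  ∑ o' ∈ Finset.univ.filter (fun o' => o ≤ o'), (M.outcomeLaw x o').toReal

lemma tailProb_nonneg (x : Fin m → ℝ) (o : Fin (m + 1)) : 0 ≤ M.tailProb x o :=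
  Finset.sum_nonneg fun _ _ => ENNReal.toReal_nonneg

lemma tailProb_mono (hF : M.FOSD) (hT : M.ConsistentTies) {x y : Fin m → ℝ}
    (hx : x ∈ weaklyBounded m) (hy : y ∈ weaklyBounded m) (hxy : x ≤ y) (o : Fin (m + 1)) :
    M.tailProb x o ≤ M.tailProb y o := by
  have key : ∀ z, ∑ o' ∈ Finset.univ.filter (fun o' => o ≤ o'), M.outcomeLaw z o' =
      ∫⁻ θ, ∑ o' ∈ Finset.univ.filter (fun o' => o ≤ o'),
        M.production θ (M.choice θ z) o' ∂M.supply := by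
    intro z
    rw [MeasureTheory.lintegral_finsetSum _ (fun o _ => M.choice_measurable z o)]
    rfl
  unfold tailProb
  rw [← ENNReal.toReal_sum fun o' _ => PMF.apply_ne_top _ _,
    ← ENNReal.toReal_sum fun o' _ => PMF.apply_ne_top _ _]
  refine ENNReal.toReal_mono (ENNReal.sum_ne_top.2 fun o' _ => PMF.apply_ne_top _ _) ?_
  rw [key, key]
  refine MeasureTheory.lintegral_mono fun θ => ?_
  have h := M.upperProb_choice_mono hF hT hx hy hxy θ o
  unfold upperProb at h
  rw [← ENNReal.toReal_sum fun o' _ => PMF.apply_ne_top _ _,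
    ← ENNReal.toReal_sum fun o' _ => PMF.apply_ne_top _ _] at h
  exact (ENNReal.toReal_le_toReal (ENNReal.sum_ne_top.2 fun o' _ => PMF.apply_ne_top _ _)
    (ENNReal.sum_ne_top.2 fun o' _ => PMF.apply_ne_top _ _)).1 h

lemma expValue_mono (hF : M.FOSD) (hT : M.ConsistentTies) {x y : Fin m → ℝ}
    (hx : x ∈ weaklyBounded m) (hy : y ∈ weaklyBounded m) (hxy : x ≤ y) :
    M.expValue x ≤ M.expValue y := by
  have key : ∀ z, M.expValue z = ∑ j : Fin m, (M.value j.succ - M.value j.castSucc) *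
      M.tailProb z j.succ := fun z => by
    unfold expValue tailProb
    rw [← sum_mul_pay]
    exact Finset.sum_congr rfl fun o _ => by rw [← M.value_eq_pay]
  rw [key, key]
  exact Finset.sum_le_sum fun j _ => mul_le_mul_of_nonneg_left
    (M.tailProb_mono hF hT hx hy hxy _) (sub_nonneg.2 (M.value_mono (Fin.castSucc_lt_succ).le))

lemma expPay_mono (hF : M.FOSD) (hT : M.ConsistentTies) {x y : Fin m → ℝ}
    (hx : x ∈ weaklyBounded m) (hy : y ∈ weaklyBounded m) (hxy : x ≤ y) :
    M.expPay x ≤ M.expPay y := by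
  unfold expPay
  rw [sum_mul_pay, sum_mul_pay]
  exact Finset.sum_le_sum fun j _ => mul_le_mul (hxy j) (M.tailProb_mono hF hT hx hy hxy _)
    (M.tailProb_nonneg _ _) (hy j).1

lemma outcomeLaw_sum (x : Fin m → ℝ) : ∑ o, (M.outcomeLaw x o).toReal = 1 := by
  rw [← ENNReal.toReal_sum fun o _ => PMF.apply_ne_top _ _,
    ← tsum_fintype (L := .unconditional _), PMF.tsum_coe, ENNReal.toReal_one]

lemma outcomeLaw_mean_mem {x : Fin m → ℝ} {f : Fin (m + 1) → ℝ} {a b : ℝ}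
    (hf : ∀ o, f o ∈ Set.Icc a b) : ∑ o, (M.outcomeLaw x o).toReal * f o ∈ Set.Icc a b :=
  (convex_Icc a b).sum_mem (fun _ _ => ENNReal.toReal_nonneg) (M.outcomeLaw_sum x)
    fun o _ => hf o

lemma expValue_mem (x : Fin m → ℝ) : M.expValue x ∈ Set.Icc (0 : ℝ) 1 :=
  M.outcomeLaw_mean_mem fun o => ⟨M.value_nonneg o, M.value_le_one o⟩

lemma expPay_mem {x : Fin m → ℝ} (hx : x ∈ weaklyBounded m) : M.expPay x ∈ Set.Icc (0 : ℝ) m :=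
  M.outcomeLaw_mean_mem fun o => ⟨pay_nonneg hx o, pay_le hx o⟩

end Market

/-! ### Geometry of cells -/

namespace Cell

variable {m : ℕ} {Xc : Set (Fin m → ℝ)} {C Q : Cell m}

lemma Composite.relevant (h : C.Composite Xc) : C.Relevant Xc := Set.Nontrivial.nonempty h

lemma Feasible.bounds (h : Feasible Xc C) :
    0 < C.side ∧ ∀ j, 0 ≤ C.lo j ∧ C.lo j + C.side ≤ 1 := by
  induction h with
  | root => simp [Cell.root]
  | quadrant _ hQ _ ih =>
    obtain ⟨s, rfl⟩ := hQ
    refine ⟨half_pos ih.1, fun j => ?_⟩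
    have h1 := ih.1
    have h2 := ih.2 j
    dsimp only
    split_ifs <;> constructor <;> linarith

lemma Feasible.lo_le_hi (h : Feasible Xc C) : C.lo ≤ C.hi := fun j => by
  have := h.bounds.1
  simp only [Cell.hi]
  linarith

lemma Feasible.lo_mem (h : Feasible Xc C) : C.lo ∈ weaklyBounded m := fun j =>
  ⟨(h.bounds.2 j).1, by have := h.bounds.1; have := (h.bounds.2 j).2; linarith⟩

lemma Feasible.hi_mem (h : Feasible Xc C) : C.hi ∈ weaklyBounded m := fun j =>
  ⟨(h.lo_mem j).1.trans (h.lo_le_hi j), (h.bounds.2 j).2⟩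

lemma Composite.hi_ne_lo (h : C.Composite Xc) : C.hi ≠ C.lo := by
  intro h'
  obtain ⟨x, hx, y, hy, hxy⟩ := h
  have key : ∀ z ∈ C.toSet ∩ Xc, z = C.lo := fun z hz =>
    le_antisymm (h' ▸ hz.1.2) hz.1.1
  exact hxy ((key x hx).trans (key y hy).symm)

lemma quadrants_lo_le (hC : 0 ≤ C.side) (h : Q ∈ C.quadrants) : C.lo ≤ Q.lo := by
  obtain ⟨s, rfl⟩ := h
  intro j
  dsimp only
  split_ifs <;> linarith

lemma quadrants_hi_le (hC : 0 ≤ C.side) (h : Q ∈ C.quadrants) : Q.hi ≤ C.hi := by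
  obtain ⟨s, rfl⟩ := h
  intro j
  simp only [Cell.hi]
  split_ifs <;> linarith

lemma quadrants_side (h : Q ∈ C.quadrants) : Q.side = C.side / 2 := by
  obtain ⟨s, rfl⟩ := h
  rfl

lemma quadrants_toSet_subset (hC : 0 ≤ C.side) (h : Q ∈ C.quadrants) : Q.toSet ⊆ C.toSet :=
  Set.Icc_subset_Icc (quadrants_lo_le hC h) (quadrants_hi_le hC h)

lemma exists_quadrant_mem {x : Fin m → ℝ} (hx : x ∈ C.toSet) :
    ∃ Q ∈ C.quadrants, x ∈ Q.toSet := by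
  classical
  refine ⟨_, ⟨fun j => decide (C.lo j + C.side / 2 ≤ x j), rfl⟩, fun j => ?_, fun j => ?_⟩
  · have := hx.1 j
    simp only [decide_eq_true_eq]
    split_ifs <;> linarith
  · have := hx.2 j
    simp only [Cell.hi, decide_eq_true_eq] at this ⊢
    split_ifs <;> linarith

lemma quadrants_encard_le (C : Cell m) : C.quadrants.encard ≤ 2 ^ m := by
  unfold quadrants
  rw [← Set.image_univ]
  refine (Set.encard_image_le _ _).trans ?_
  rw [Set.encard_univ, ENat.card_eq_coe_fintype_card]
  simp

/-- The half-open cube with the same corners. Half-open quadrants are disjoint, closed ones share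
faces. -/
def box (C : Cell m) : Set (Fin m → ℝ) := {x | ∀ j, C.lo j ≤ x j ∧ x j < C.lo j + C.side}

lemma lo_mem_box (h : 0 < C.side) : C.lo ∈ C.box := fun _ => ⟨le_rfl, by linarith⟩

lemma quadrants_box_subset (hC : 0 ≤ C.side) (h : Q ∈ C.quadrants) : Q.box ⊆ C.box :=
  fun _ hx j => ⟨(quadrants_lo_le hC h j).trans (hx j).1,
    (hx j).2.trans_le (quadrants_hi_le hC h j)⟩

lemma quadrants_disjoint {Q' : Cell m} (h : Q ∈ C.quadrants) (h' : Q' ∈ C.quadrants)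
    (hne : Q ≠ Q') : Disjoint Q.box Q'.box := by
  obtain ⟨s, rfl⟩ := h
  obtain ⟨s', rfl⟩ := h'
  have hs : s ≠ s' := fun h => hne (by rw [h])
  obtain ⟨j, hj⟩ := Function.ne_iff.1 hs
  rw [Set.disjoint_left]
  intro x hx hx'
  have h1 := hx j
  have h2 := hx' j
  dsimp only at h1 h2
  cases hsj : s j <;> cases hsj' : s' j <;> simp_all <;> linarith

open Classical in
/-- The two anchors of a cell; for an atomic cell both are its unique candidate contract. -/
def anchor (Xc : Set (Fin m → ℝ)) (C : Cell m) (b : Bool) : Fin m → ℝ :=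
  if C.Composite Xc then (if b then C.hi else C.lo)
  else Classical.epsilon fun x => x ∈ C.toSet ∩ Xc

lemma anchorLaw_eq (Xc : Set (Fin m → ℝ)) (C : Cell m) :
    C.anchorLaw Xc = (PMF.uniformOfFintype Bool).map (C.anchor Xc) := by
  unfold anchorLaw
  split_ifs with h
  · congr 1
    ext1 b
    simp [anchor, h]
  · have : C.anchor Xc = Function.const Bool (Classical.epsilon fun x => x ∈ C.toSet ∩ Xc) := by
      ext1 b
      simp [anchor, h]
    rw [this, PMF.map_const]

lemma anchor_true (h : C.Composite Xc) : C.anchor Xc true = C.hi := by simp [anchor, h]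

lemma anchor_false (h : C.Composite Xc) : C.anchor Xc false = C.lo := by simp [anchor, h]

lemma anchor_atomic (hR : C.Relevant Xc) (h : ¬ C.Composite Xc) (b : Bool) {x : Fin m → ℝ}
    (hx : x ∈ C.toSet ∩ Xc) : C.anchor Xc b = x := by
  have h1 : C.anchor Xc b ∈ C.toSet ∩ Xc := by
    simp only [anchor, if_neg h]
    exact Classical.epsilon_spec hR
  exact (Set.not_nontrivial_iff.1 h) h1 hx

lemma Feasible.anchor_mem (hF : Feasible Xc C) (b : Bool) : C.anchor Xc b ∈ C.toSet ∨
    ¬ C.Relevant Xc := by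
  by_cases hR : C.Relevant Xc
  · left
    by_cases h : C.Composite Xc
    · cases b
      · rw [anchor_false h]; exact ⟨le_rfl, hF.lo_le_hi⟩
      · rw [anchor_true h]; exact ⟨hF.lo_le_hi, le_rfl⟩
    · obtain ⟨x, hx⟩ := hR
      rw [anchor_atomic ⟨x, hx⟩ h b hx]
      exact hx.1
  · exact Or.inr hR

lemma Feasible.toSet_subset (hF : Feasible Xc C) : C.toSet ⊆ weaklyBounded m := fun _ hx j =>
  ⟨(hF.lo_mem j).1.trans (hx.1 j), (hx.2 j).trans (hF.hi_mem j).2⟩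

lemma weaklyBounded_eq_root (m : ℕ) : weaklyBounded m = (root m).toSet := by
  ext x
  simp only [weaklyBounded, Set.mem_ofPred_eq, toSet, Set.mem_Icc, Pi.le_def, root, hi, zero_add]
  exact forall_and

end Cell

/-! ### Utility and virtual width on a cell -/

namespace Market

variable {m : ℕ} {E : Type u} {Θ : Type v} [MeasurableSpace Θ] (M : Market m E Θ)
  {Xc : Set (Fin m → ℝ)} {C Q : Cell m}

/-- Expected utility of the requester when a uniformly random anchor of `C` is posted. -/
def cellUtility (Xc : Set (Fin m → ℝ)) (C : Cell m) : ℝ :=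
  (M.utility (C.anchor Xc true) + M.utility (C.anchor Xc false)) / 2

/-- The least utility that monotonicity of value and payment allows in `C`; the greatest is larger
by the virtual width. -/
def minUtility (C : Cell m) : ℝ := M.expValue C.lo - M.expPay C.hi

lemma minUtility_le (hF : M.FOSD) (hT : M.ConsistentTies) (hC : Cell.Feasible Xc C)
    {x : Fin m → ℝ} (hx : x ∈ C.toSet) : M.minUtility C ≤ M.utility x := by
  have hw := hC.toSet_subset hx
  have h1 := M.expValue_mono hF hT hC.lo_mem hw hx.1
  have h2 := M.expPay_mono hF hT hw hC.hi_mem hx.2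
  unfold minUtility utility
  linarith

lemma le_minUtility_add (hF : M.FOSD) (hT : M.ConsistentTies) (hC : Cell.Feasible Xc C)
    {x : Fin m → ℝ} (hx : x ∈ C.toSet) :
    M.utility x ≤ M.minUtility C + M.virtualWidth C := by
  have hw := hC.toSet_subset hx
  have h1 := M.expValue_mono hF hT hw hC.hi_mem hx.2
  have h2 := M.expPay_mono hF hT hC.lo_mem hw hx.1
  unfold minUtility utility virtualWidth
  linarith

lemma virtualWidth_nonneg (hF : M.FOSD) (hT : M.ConsistentTies) (hC : Cell.Feasible Xc C) :
    0 ≤ M.virtualWidth C := by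
  have h1 := M.expValue_mono hF hT hC.lo_mem hC.hi_mem hC.lo_le_hi
  have h2 := M.expPay_mono hF hT hC.lo_mem hC.hi_mem hC.lo_le_hi
  unfold virtualWidth
  linarith

lemma virtualWidth_le (hC : Cell.Feasible Xc C) : M.virtualWidth C ≤ m + 1 := by
  have h1 := M.expValue_mem C.lo
  have h2 := M.expPay_mem hC.lo_mem
  have h3 := M.expValue_mem C.hi
  have h4 := M.expPay_mem hC.hi_mem
  unfold virtualWidth
  linarith [h1.1, h2.1, h3.2, h4.2]

lemma virtualWidth_quadrant_le (hF : M.FOSD) (hT : M.ConsistentTies) (hC : Cell.Feasible Xc C)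
    (hQ : Cell.Feasible Xc Q) (h : Q ∈ C.quadrants) : M.virtualWidth Q ≤ M.virtualWidth C := by
  have hl := Cell.quadrants_lo_le hC.bounds.1.le h
  have hh := Cell.quadrants_hi_le hC.bounds.1.le h
  have h1 := M.expValue_mono hF hT hC.lo_mem hQ.lo_mem hl
  have h2 := M.expPay_mono hF hT hC.lo_mem hQ.lo_mem hl
  have h3 := M.expValue_mono hF hT hQ.hi_mem hC.hi_mem hh
  have h4 := M.expPay_mono hF hT hQ.hi_mem hC.hi_mem hh
  unfold virtualWidth
  linarith

lemma cellUtility_atomic (hR : C.Relevant Xc) (h : ¬ C.Composite Xc) {x : Fin m → ℝ}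
    (hx : x ∈ C.toSet ∩ Xc) : M.cellUtility Xc C = M.utility x := by
  unfold cellUtility
  rw [Cell.anchor_atomic hR h _ hx, Cell.anchor_atomic hR h _ hx]
  ring

lemma minUtility_le_cellUtility (hF : M.FOSD) (hT : M.ConsistentTies) {D : Cell m}
    (hD : Cell.Feasible Xc D) (hC : Cell.Feasible Xc C) (hR : C.Relevant Xc)
    (h : C.toSet ⊆ D.toSet) : M.minUtility D ≤ M.cellUtility Xc C := by
  have key : ∀ b, M.minUtility D ≤ M.utility (C.anchor Xc b) := fun b =>
    M.minUtility_le hF hT hD (h ((hC.anchor_mem b).resolve_right (not_not.2 hR)))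
  have h1 := key true
  have h2 := key false
  unfold cellUtility
  linarith

lemma cellUtility_le (hF : M.FOSD) (hT : M.ConsistentTies) (hC : Cell.Feasible Xc C)
    (hR : C.Relevant Xc) : M.cellUtility Xc C ≤ M.minUtility C + M.virtualWidth C := by
  have key : ∀ b, M.utility (C.anchor Xc b) ≤ M.minUtility C + M.virtualWidth C := fun b =>
    M.le_minUtility_add hF hT hC ((hC.anchor_mem b).resolve_right (not_not.2 hR))
  have h1 := key true
  have h2 := key false
  unfold cellUtility
  linarith

lemma utility_le_one {x : Fin m → ℝ} (hx : x ∈ weaklyBounded m) : M.utility x ≤ 1 := by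
  have h1 := M.expValue_mem x
  have h2 := M.expPay_mem hx
  unfold utility
  linarith [h1.2, h2.1]

lemma neg_le_utility {x : Fin m → ℝ} (hx : x ∈ weaklyBounded m) : -(m : ℝ) ≤ M.utility x := by
  have h1 := M.expValue_mem x
  have h2 := M.expPay_mem hx
  unfold utility
  linarith [h1.1, h2.2]

lemma opt_le_one (hX : Xc ⊆ boundedMonotone m) (hne : Xc.Nonempty) : M.opt Xc ≤ 1 := by
  refine csSup_le (hne.image _) ?_
  rintro _ ⟨y, hy, rfl⟩
  exact M.utility_le_one (boundedMonotone_subset (hX hy))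

lemma neg_le_cellUtility (hC : Cell.Feasible Xc C) (hR : C.Relevant Xc) :
    -(m : ℝ) ≤ M.cellUtility Xc C := by
  have key : ∀ b, -(m : ℝ) ≤ M.utility (C.anchor Xc b) := fun b =>
    M.neg_le_utility (hC.toSet_subset ((hC.anchor_mem b).resolve_right (not_not.2 hR)))
  have h1 := key true
  have h2 := key false
  unfold cellUtility
  linarith

open Classical in
/-- The virtual width of a composite cell, and zero for an atomic one. -/
def cellWidth (Xc : Set (Fin m → ℝ)) (C : Cell m) : ℝ :=
  if C.Composite Xc then M.virtualWidth C else 0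

lemma cellWidth_nonneg (hF : M.FOSD) (hT : M.ConsistentTies) (hC : Cell.Feasible Xc C) :
    0 ≤ M.cellWidth Xc C := by
  unfold cellWidth
  split_ifs
  · exact M.virtualWidth_nonneg hF hT hC
  · exact le_rfl

/-- The utilities of the candidates in a cell differ from that of a random anchor by at most the
width of the cell. -/
lemma abs_utility_sub_cellUtility_le (hF : M.FOSD) (hT : M.ConsistentTies)
    (hC : Cell.Feasible Xc C) {x : Fin m → ℝ} (hx : x ∈ C.toSet ∩ Xc) :
    |M.utility x - M.cellUtility Xc C| ≤ M.cellWidth Xc C := by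
  have hR : C.Relevant Xc := ⟨x, hx⟩
  unfold cellWidth
  split_ifs with h
  · have h1 := M.minUtility_le hF hT hC hx.1
    have h2 := M.le_minUtility_add hF hT hC hx.1
    have h3 := M.minUtility_le_cellUtility hF hT hC hC hR subset_rfl
    have h4 := M.cellUtility_le hF hT hC hR
    rw [abs_le]
    constructor <;> linarith
  · rw [M.cellUtility_atomic hR h hx]
    simp

/-- The larger of the regret per round and the width of a cell: both are of the order of the
confidence radius at the last time the cell is chosen. -/
def badness (Xc : Set (Fin m → ℝ)) (C : Cell m) : ℝ :=
  max (M.opt Xc - M.cellUtility Xc C) (M.cellWidth Xc C)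

lemma badness_nonneg (hF : M.FOSD) (hT : M.ConsistentTies) (hC : Cell.Feasible Xc C) :
    0 ≤ M.badness Xc C := (M.cellWidth_nonneg hF hT hC).trans (le_max_right _ _)

lemma badness_le (hX : Xc ⊆ boundedMonotone m)
    (hC : Cell.Feasible Xc C) (hR : C.Relevant Xc) : M.badness Xc C ≤ m + 1 := by
  have hne : Xc.Nonempty := hR.mono Set.inter_subset_right
  refine max_le ?_ ?_
  · linarith [M.opt_le_one hX hne, M.neg_le_cellUtility hC hR]
  · unfold cellWidth
    split_ifs
    · exact M.virtualWidth_le hC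
    · positivity

end Market

/-! ### Hoeffding's lemma for finite distributions -/

lemma sum_mul_exp_le_of_mem_Icc {ι : Type*} [Fintype ι] {p y : ι → ℝ} {a b : ℝ}
    (hp : ∀ i, 0 ≤ p i) (hsum : ∑ i, p i = 1) (hy : ∀ i, y i ∈ Set.Icc a b)
    (hmean : ∑ i, p i * y i = 0) (t : ℝ) :
    ∑ i, p i * Real.exp (t * y i) ≤ Real.exp (t ^ 2 * (b - a) ^ 2 / 8) := by
  let _ : MeasurableSpace ι := ⊤
  have hs : ∑ i, ENNReal.ofReal (p i) = 1 := by
    rw [← ENNReal.ofReal_sum_of_nonneg fun i _ => hp i, hsum, ENNReal.ofReal_one]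
  let P : PMF ι := PMF.ofFintype _ hs
  have hint : ∀ f : ι → ℝ, ∫ i, f i ∂P.toMeasure = ∑ i, p i * f i := by
    intro f
    rw [PMF.integral_eq_sum]
    refine Finset.sum_congr rfl fun i _ => ?_
    rw [PMF.ofFintype_apply, ENNReal.toReal_ofReal (hp i), smul_eq_mul]
  have h := ProbabilityTheory.hasSubgaussianMGF_of_mem_Icc_of_integral_eq_zero (μ := P.toMeasure)
    (X := y) (a := a) (b := b) (measurable_from_top).aemeasurable
    (Filter.Eventually.of_forall hy) (by rw [hint, hmean])
  have h2 := h.mgf_le t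
  rw [ProbabilityTheory.mgf, hint] at h2
  refine h2.trans (Real.exp_le_exp.2 (le_of_eq ?_))
  push_cast
  rw [Real.norm_eq_abs, div_pow, sq_abs]
  ring

/-! ### Means over histories -/

section PMF

variable {α β : Type*}

lemma summable_of_support_finite {p : PMF α} (hp : p.support.Finite) (f : α → ℝ) :
    Summable fun a => (p a).toReal * f a := by
  refine summable_of_hasFiniteSupport (hp.subset fun a ha => ?_)
  rw [PMF.mem_support_iff]
  rintro h
  simp [h] at ha

lemma tsum_bind_mul {p : PMF α} {q : α → PMF β} (hp : p.support.Finite)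
    (hq : ∀ a, (q a).support.Finite) (f : β → ℝ) :
    ∑' b, ((p.bind q) b).toReal * f b = ∑' a, (p a).toReal * ∑' b, (q a b).toReal * f b := by
  have hz : ∀ a ∉ hp.toFinset, p a = 0 := fun a ha => by
    rwa [Set.Finite.mem_toFinset, PMF.mem_support_iff, not_not] at ha
  have h1 : ∀ b, ((p.bind q) b).toReal * f b =
      ∑ a ∈ hp.toFinset, (p a).toReal * ((q a b).toReal * f b) := by
    intro b
    rw [PMF.bind_apply, tsum_eq_sum (s := hp.toFinset) fun a ha => by rw [hz a ha, zero_mul],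
      ENNReal.toReal_sum fun a _ => ENNReal.mul_ne_top (PMF.apply_ne_top _ _)
        (PMF.apply_ne_top _ _), Finset.sum_mul]
    simp only [ENNReal.toReal_mul, mul_assoc]
  simp_rw [h1]
  rw [Summable.tsum_finsetSum fun a _ => (summable_of_support_finite (hq a) f).mul_left _,
    tsum_eq_sum (s := hp.toFinset) fun a ha => by rw [hz a ha]; simp]
  simp_rw [tsum_mul_left]

lemma support_map_finite {p : PMF α} (hp : p.support.Finite) (g : α → β) :
    (p.map g).support.Finite := by
  rw [PMF.support_map]
  exact hp.image _

lemma support_bind_finite {p : PMF α} {q : α → PMF β} (hp : p.support.Finite)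
    (hq : ∀ a, (q a).support.Finite) : (p.bind q).support.Finite := by
  rw [PMF.support_bind]
  exact hp.biUnion fun a _ => hq a

lemma tsum_pure_mul (a : α) (f : α → ℝ) : ∑' b, (PMF.pure a b).toReal * f b = f a := by
  rw [tsum_eq_single a fun b hb => by simp [hb]]
  simp

lemma tsum_map_mul {p : PMF α} (hp : p.support.Finite) (g : α → β) (f : β → ℝ) :
    ∑' b, ((p.map g) b).toReal * f b = ∑' a, (p a).toReal * f (g a) := by
  have h := tsum_bind_mul (q := fun a => PMF.pure (g a)) hp
    (fun a => by rw [PMF.support_pure]; exact Set.finite_singleton _) f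
  simp_rw [tsum_pure_mul] at h
  exact h

end PMF

/-- The round in which cell `C` is chosen, its anchor number `p.1` is posted and the outcome is
`p.2`. -/
def roundAt {m : ℕ} (Xc : Set (Fin m → ℝ)) (C : Cell m) (p : Bool × Fin (m + 1)) : Round m :=
  ⟨C, C.anchor Xc p.1, p.2⟩

/-- The histories that can arise when `select` chooses the cells. -/
inductive IsRun {m : ℕ} (Xc : Set (Fin m → ℝ)) (select : List (Round m) → Cell m) :
    List (Round m) → Prop
  | nil : IsRun Xc select []
  | cons {h : List (Round m)} (p : Bool × Fin (m + 1)) :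
      IsRun Xc select h → IsRun Xc select (roundAt Xc (select h) p :: h)

lemma sum_map_const_sub {α : Type*} (a : ℝ) (f : α → ℝ) (l : List α) :
    (l.map fun r => a - f r).sum = l.length * a - (l.map f).sum := by
  induction l with
  | nil => simp
  | cons r l ih => simp only [List.map_cons, List.sum_cons, ih, List.length_cons]; push_cast; ring

namespace Market

variable {m : ℕ} {E : Type u} {Θ : Type v} [MeasurableSpace Θ] (M : Market m E Θ)
  {Xc : Set (Fin m → ℝ)} {select : List (Round m) → Cell m} {C : Cell m}

/-- The probability of `roundAt Xc C p` once `C` is chosen. -/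
def roundWeight (Xc : Set (Fin m → ℝ)) (C : Cell m) (p : Bool × Fin (m + 1)) : ℝ :=
  (M.outcomeLaw (C.anchor Xc p.1) p.2).toReal / 2

/-- The mean of `f` over a round in which `C` is chosen. -/
def roundMean (Xc : Set (Fin m → ℝ)) (C : Cell m) (f : Round m → ℝ) : ℝ :=
  ∑ p, M.roundWeight Xc C p * f (roundAt Xc C p)

/-- The mean of `f` over the history after a number of rounds, as an iterated finite sum. -/
def histMean (Xc : Set (Fin m → ℝ)) (select : List (Round m) → Cell m) :
    ℕ → (List (Round m) → ℝ) → ℝ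
  | 0, f => f []
  | n + 1, f => histMean Xc select n fun h => M.roundMean Xc (select h) fun r => f (r :: h)

lemma roundWeight_nonneg (p : Bool × Fin (m + 1)) : 0 ≤ M.roundWeight Xc C p :=
  div_nonneg ENNReal.toReal_nonneg zero_le_two

lemma roundWeight_sum : ∑ p, M.roundWeight Xc C p = 1 := by
  unfold roundWeight
  rw [Fintype.sum_prod_type]
  simp_rw [← Finset.sum_div, M.outcomeLaw_sum]
  simp

lemma roundMean_mono {f g : Round m → ℝ}
    (h : ∀ p, f (roundAt Xc C p) ≤ g (roundAt Xc C p)) :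
    M.roundMean Xc C f ≤ M.roundMean Xc C g :=
  Finset.sum_le_sum fun p _ => mul_le_mul_of_nonneg_left (h p) (M.roundWeight_nonneg p)

lemma roundMean_const (a : ℝ) : M.roundMean Xc C (fun _ => a) = a := by
  unfold roundMean
  rw [← Finset.sum_mul, M.roundWeight_sum, one_mul]

lemma roundMean_add (f g : Round m → ℝ) :
    M.roundMean Xc C (fun r => f r + g r) = M.roundMean Xc C f + M.roundMean Xc C g := by
  unfold roundMean
  simp_rw [mul_add]
  rw [Finset.sum_add_distrib]

lemma roundMean_const_mul (a : ℝ) (f : Round m → ℝ) :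
    M.roundMean Xc C (fun r => a * f r) = a * M.roundMean Xc C f := by
  unfold roundMean
  rw [Finset.mul_sum]
  exact Finset.sum_congr rfl fun p _ => by ring

lemma histMean_mono {f g : List (Round m) → ℝ} {n : ℕ}
    (hfg : ∀ h, IsRun Xc select h → h.length = n → f h ≤ g h) :
    M.histMean Xc select n f ≤ M.histMean Xc select n g := by
  induction n generalizing f g with
  | zero => exact hfg [] .nil rfl
  | succ n ih =>
    refine ih fun h hr hl => M.roundMean_mono fun p => hfg _ (.cons p hr) (by simp [hl])

lemma histMean_congr {f g : List (Round m) → ℝ} {n : ℕ}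
    (hfg : ∀ h, IsRun Xc select h → h.length = n → f h = g h) :
    M.histMean Xc select n f = M.histMean Xc select n g :=
  le_antisymm (M.histMean_mono fun h hr hl => (hfg h hr hl).le)
    (M.histMean_mono fun h hr hl => (hfg h hr hl).ge)

lemma histMean_const (n : ℕ) (a : ℝ) : M.histMean Xc select n (fun _ => a) = a := by
  induction n with
  | zero => rfl
  | succ n ih => simp only [histMean, roundMean_const, ih]

lemma histMean_add (n : ℕ) (f g : List (Round m) → ℝ) :
    M.histMean Xc select n (fun h => f h + g h) =
      M.histMean Xc select n f + M.histMean Xc select n g := by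
  induction n generalizing f g with
  | zero => rfl
  | succ n ih => simp only [histMean, roundMean_add, ih]

lemma histMean_const_mul (n : ℕ) (a : ℝ) (f : List (Round m) → ℝ) :
    M.histMean Xc select n (fun h => a * f h) = a * M.histMean Xc select n f := by
  induction n generalizing f with
  | zero => rfl
  | succ n ih => simp only [histMean, roundMean_const_mul, ih]

lemma histMean_sum {ι : Type*} (s : Finset ι) (n : ℕ) (f : ι → List (Round m) → ℝ) :
    M.histMean Xc select n (fun h => ∑ i ∈ s, f i h) =
      ∑ i ∈ s, M.histMean Xc select n (f i) := by
  classical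
  induction s using Finset.induction_on with
  | empty => simpa using M.histMean_const n 0
  | insert i s hi ih =>
    simp only [Finset.sum_insert hi]
    rw [M.histMean_add, ih]

lemma anchorLaw_support_finite (C : Cell m) : (C.anchorLaw Xc).support.Finite := by
  rw [Cell.anchorLaw_eq]
  exact support_map_finite (Set.toFinite _) _

lemma tsum_round_mul (h : List (Round m)) (f : List (Round m) → ℝ) :
    ∑' l, ((((C.anchorLaw Xc).bind fun x =>
        (M.outcomeLaw x).map fun o => (⟨C, x, o⟩ : Round m) :: h) l).toReal * f l) =
      M.roundMean Xc C fun r => f (r :: h) := by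
  rw [tsum_bind_mul (anchorLaw_support_finite C)
    fun x => support_map_finite (Set.toFinite _) _]
  simp_rw [tsum_map_mul (Set.toFinite _)]
  rw [Cell.anchorLaw_eq, tsum_map_mul (Set.toFinite _)]
  simp only [tsum_fintype, roundMean, roundWeight, roundAt, Fintype.sum_prod_type,
    PMF.uniformOfFintype_apply, Fintype.card_bool, Finset.mul_sum]
  refine Finset.sum_congr rfl fun b _ => Finset.sum_congr rfl fun o _ => ?_
  simp
  ring

lemma historyLaw_support_finite (n : ℕ) : (M.historyLaw Xc select n).support.Finite := by
  induction n with
  | zero => simp [historyLaw]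
  | succ n ih =>
    exact support_bind_finite ih fun h => support_bind_finite (anchorLaw_support_finite _)
      fun x => support_map_finite (Set.toFinite _) _

lemma tsum_historyLaw_mul (n : ℕ) (f : List (Round m) → ℝ) :
    ∑' h, (M.historyLaw Xc select n h).toReal * f h = M.histMean Xc select n f := by
  induction n generalizing f with
  | zero => exact tsum_pure_mul _ _
  | succ n ih =>
    rw [historyLaw, tsum_bind_mul (M.historyLaw_support_finite n) fun h =>
      support_bind_finite (anchorLaw_support_finite _)
        fun x => support_map_finite (Set.toFinite _) _]
    simp_rw [tsum_round_mul]
    rw [ih]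
    rfl

lemma utility_eq_sum (x : Fin m → ℝ) :
    M.utility x = ∑ o, (M.outcomeLaw x o).toReal * (M.value o - pay x o) := by
  unfold utility expValue expPay
  rw [← Finset.sum_sub_distrib]
  exact Finset.sum_congr rfl fun o _ => by ring

lemma roundMean_gain : M.roundMean Xc C (Round.gain M.value) = M.cellUtility Xc C := by
  unfold roundMean cellUtility
  rw [Fintype.sum_prod_type, Fintype.sum_bool, utility_eq_sum, utility_eq_sum, add_div,
    Finset.sum_div, Finset.sum_div]
  simp only [roundWeight, roundAt, Round.gain]
  congr 1 <;> exact Finset.sum_congr rfl fun o _ => by ring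

lemma histMean_gain (n : ℕ) :
    M.histMean Xc select n (fun h => (h.map (Round.gain M.value)).sum) =
      M.histMean Xc select n (fun h => (h.map fun r => M.cellUtility Xc r.cell).sum) := by
  induction n with
  | zero => rfl
  | succ n ih =>
    simp only [histMean, List.map_cons, List.sum_cons, roundMean_add, roundMean_gain,
      roundMean_const, histMean_add, ih]
    congr 1
    refine M.histMean_congr fun h _ _ => ?_
    exact (M.roundMean_const (Xc := Xc) (C := select h) _).symm.trans rfl

/-- The regret is the mean of the sum of the expected regrets of the chosen cells. -/
lemma regret_eq (T : ℕ) : M.regret Xc select T =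
    M.histMean Xc select T
      (fun h => (h.map fun r => M.opt Xc - M.cellUtility Xc r.cell).sum) := by
  unfold regret expTotalUtility
  rw [tsum_historyLaw_mul, histMean_gain]
  have h1 : M.histMean Xc select T
      (fun h => (h.map fun r => M.opt Xc - M.cellUtility Xc r.cell).sum) =
      M.histMean Xc select T (fun h => T * M.opt Xc +
        (-1) * (h.map fun r => M.cellUtility Xc r.cell).sum) :=
    M.histMean_congr fun h _ hl => by rw [sum_map_const_sub, hl]; ring
  rw [h1, histMean_add, histMean_const, histMean_const_mul]
  ring

end Market

/-! ### Concentration of the statistics of the chosen cells -/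

section

open Classical

variable {m : ℕ}

lemma plays_cons_self (r : Round m) (h : List (Round m)) :
    plays (r :: h) r.cell = r :: plays h r.cell := by
  simp [plays]

lemma plays_cons_of_ne {r : Round m} (h : List (Round m)) {C : Cell m} (hC : r.cell ≠ C) :
    plays (r :: h) C = plays h C := by
  simp [plays, hC]

/-- The cells that were chosen in a history. -/
def playedCells (h : List (Round m)) : Finset (Cell m) := (h.map Round.cell).toFinset

lemma mem_playedCells {h : List (Round m)} {C : Cell m} : C ∈ playedCells h ↔ plays h C ≠ [] := by
  simp [playedCells, plays]

lemma playedCells_cons (r : Round m) (h : List (Round m)) :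
    playedCells (r :: h) = insert r.cell (playedCells h) := by
  simp [playedCells]

lemma length_plays_le (h : List (Round m)) (C : Cell m) : (plays h C).length ≤ h.length :=
  List.length_filter_le _ _

/-- The sum over the chosen cells of the exponential of the sum of `g` over the rounds of the cell.
Only one summand changes in a round, and at most one is new; this makes a union bound over the
randomly generated cells unnecessary. -/
def potential (g : Round m → ℝ) (h : List (Round m)) : ℝ :=
  ∑ C ∈ playedCells h, Real.exp ((plays h C).map g).sum

lemma exp_le_potential (g : Round m → ℝ) {h : List (Round m)} {C : Cell m}
    (hC : C ∈ playedCells h) : Real.exp ((plays h C).map g).sum ≤ potential g h :=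
  Finset.single_le_sum (f := fun C => Real.exp ((plays h C).map g).sum)
    (fun _ _ => (Real.exp_pos _).le) hC

lemma potential_nonneg (g : Round m → ℝ) (h : List (Round m)) : 0 ≤ potential g h :=
  Finset.sum_nonneg fun _ _ => (Real.exp_pos _).le

lemma potential_cons (g : Round m → ℝ) (r : Round m) (h : List (Round m)) :
    potential g (r :: h) = Real.exp ((plays h r.cell).map g).sum * Real.exp (g r) +
      ∑ C ∈ (playedCells h).erase r.cell, Real.exp ((plays h C).map g).sum := by
  have hins : insert r.cell (playedCells h) = insert r.cell ((playedCells h).erase r.cell) := by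
    ext C
    by_cases hC : C = r.cell <;> simp [hC]
  unfold potential
  rw [playedCells_cons, hins, Finset.sum_insert (Finset.notMem_erase _ _), plays_cons_self,
    List.map_cons, List.sum_cons, Real.exp_add, mul_comm]
  congr 1
  refine Finset.sum_congr rfl fun C hC => ?_
  rw [plays_cons_of_ne h (Finset.ne_of_mem_erase hC).symm]

lemma exp_add_sum_erase_le (g : Round m → ℝ) (h : List (Round m)) (C : Cell m) :
    Real.exp ((plays h C).map g).sum +
      ∑ D ∈ (playedCells h).erase C, Real.exp ((plays h D).map g).sum ≤ potential g h + 1 := by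
  by_cases hC : C ∈ playedCells h
  · rw [Finset.add_sum_erase _ (fun D => Real.exp ((plays h D).map g).sum) hC]
    exact (lt_add_one _).le
  · rw [Finset.erase_eq_of_notMem hC]
    rw [mem_playedCells, not_not] at hC
    rw [hC, List.map_nil, List.sum_nil, Real.exp_zero, add_comm]
    rfl

/-- The rounds of `C` that satisfy `A` show a deviation of the sum of `φ` beyond the confidence
bound for variables of range `R`. -/
def Deviates (T : ℕ) (R : ℝ) (A : Round m → Prop) (φ : Round m → ℝ) (h : List (Round m)) : Prop :=
  ∃ C, (plays h C).filter A ≠ [] ∧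
    R * Real.sqrt (2 * ((plays h C).filter A).length * Real.log T) ≤
      |(((plays h C).filter A).map φ).sum|

/-- The exponent of the exponential supermartingale of Hoeffding's inequality. -/
def hoeffdingExponent (R : ℝ) (A : Round m → Prop) (φ : Round m → ℝ) (t : ℝ) (r : Round m) : ℝ :=
  if A r then t * φ r - t ^ 2 * R ^ 2 / 8 else 0

lemma sum_hoeffdingExponent (R : ℝ) (A : Round m → Prop) (φ : Round m → ℝ) (t : ℝ)
    (l : List (Round m)) :
    (l.map (hoeffdingExponent R A φ t)).sum =
      t * ((l.filter A).map φ).sum - (l.filter A).length * (t ^ 2 * R ^ 2 / 8) := by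
  induction l with
  | nil => simp
  | cons r l ih =>
    by_cases hr : A r
    · rw [List.filter_cons_of_pos (by simpa using hr)]
      simp only [List.map_cons, List.sum_cons, List.length_cons, ih]
      rw [hoeffdingExponent, if_pos hr]
      push_cast
      ring
    · rw [List.filter_cons_of_neg (by simpa using hr)]
      simp only [List.map_cons, List.sum_cons, ih]
      rw [hoeffdingExponent, if_neg hr, zero_add]

/-- At the optimal parameter, a deviation makes the supermartingale exceed `T ^ 4`. -/
lemma Deviates.exists_potential {T : ℕ} (hT : 1 < T) {R : ℝ} (hR : 0 < R) {A : Round m → Prop}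
    {φ : Round m → ℝ} {h : List (Round m)} (hd : Deviates T R A φ h) (hl : h.length ≤ T) :
    ∃ k ∈ Finset.Icc 1 T, ∃ s ∈ ({1, -1} : Finset ℝ), (T : ℝ) ^ 4 ≤
      potential (hoeffdingExponent R A φ (s * (4 * Real.sqrt (2 * k * Real.log T) / (k * R)))) h := by
  obtain ⟨C, hne, hC⟩ := hd
  have hplays : plays h C ≠ [] := fun h0 => hne (by simp [h0])
  set l := (plays h C).filter A with hl_def
  have hk : 0 < l.length := List.length_pos_iff.2 hne
  have hkR : (0 : ℝ) < l.length := by exact_mod_cast hk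
  have hT' : (1 : ℝ) < T := by exact_mod_cast hT
  have hlog : 0 < Real.log T := Real.log_pos hT'
  set a := Real.sqrt (2 * l.length * Real.log T) with ha
  have ha2 : a ^ 2 = 2 * l.length * Real.log T := Real.sq_sqrt (by positivity)
  have ha0 : 0 ≤ a := Real.sqrt_nonneg _
  obtain ⟨s, hs, hsabs⟩ : ∃ s ∈ ({1, -1} : Finset ℝ), s * (l.map φ).sum = |(l.map φ).sum| := by
    rcases abs_choice (l.map φ).sum with h1 | h1
    · exact ⟨1, by simp, by rw [h1, one_mul]⟩
    · exact ⟨-1, by simp, by rw [h1, neg_one_mul]⟩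
  have hs2 : s ^ 2 = 1 := by
    rcases Finset.mem_insert.1 hs with h1 | h1
    · rw [h1]; norm_num
    · rw [Finset.mem_singleton.1 h1]; norm_num
  refine ⟨l.length, Finset.mem_Icc.2 ⟨hk, ?_⟩, s, hs, ?_⟩
  · exact ((List.length_filter_le _ _).trans (length_plays_le h C)).trans hl
  · refine le_trans ?_ (exp_le_potential _ (mem_playedCells.2 hplays))
    rw [sum_hoeffdingExponent, ← hl_def, ← ha]
    have h4 : (T : ℝ) ^ 4 = Real.exp (4 * Real.log T) := by
      rw [← Real.exp_log (show (0 : ℝ) < T ^ 4 by positivity), Real.log_pow]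
      norm_num
    rw [h4]
    refine Real.exp_le_exp.2 ?_
    have e1 : s * (4 * a / (l.length * R)) * (l.map φ).sum =
        4 * a / (l.length * R) * |(l.map φ).sum| := by rw [← hsabs]; ring
    have e2 : 4 * a / (l.length * R) * (R * a) ≤ 4 * a / (l.length * R) * |(l.map φ).sum| :=
      mul_le_mul_of_nonneg_left hC (by positivity)
    have e3 : 4 * a / (l.length * R) * (R * a) = 8 * Real.log T := by
      have : 4 * a / (l.length * R) * (R * a) = 4 * a ^ 2 / l.length := by
        field_simp
      rw [this, ha2]
      field_simp
      norm_num
    have e4 : (l.length : ℝ) * ((s * (4 * a / (l.length * R))) ^ 2 * R ^ 2 / 8) =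
        4 * Real.log T := by
      have : (l.length : ℝ) * ((s * (4 * a / (l.length * R))) ^ 2 * R ^ 2 / 8) =
          s ^ 2 * (2 * a ^ 2 / l.length) := by
        field_simp
        ring
      rw [this, ha2, hs2]
      field_simp
      norm_num
    rw [e1, e4]
    linarith

/-- The indicator of a proposition. -/
def indicator (p : Prop) : ℝ := if p then 1 else 0

lemma indicator_of {p : Prop} (hp : p) : indicator p = 1 := if_pos hp

lemma indicator_of_not {p : Prop} (hp : ¬ p) : indicator p = 0 := if_neg hp

lemma indicator_nonneg (p : Prop) : 0 ≤ indicator p := by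
  unfold indicator
  split_ifs <;> norm_num

lemma indicator_le_add {p q r : Prop} (h : p → q ∨ r) : indicator p ≤ indicator q + indicator r := by
  by_cases hp : p
  · rw [indicator_of hp]
    rcases h hp with h | h
    · rw [indicator_of h]
      linarith [indicator_nonneg r]
    · rw [indicator_of h]
      linarith [indicator_nonneg q]
  · rw [indicator_of_not hp]
    exact add_nonneg (indicator_nonneg q) (indicator_nonneg r)

namespace Market

variable {E : Type u} {Θ : Type v} [MeasurableSpace Θ] (M : Market m E Θ)
  {Xc : Set (Fin m → ℝ)} {select : List (Round m) → Cell m} {C : Cell m}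

/-- The probability that the history after `n` rounds satisfies `S`. -/
def histProb (Xc : Set (Fin m → ℝ)) (select : List (Round m) → Cell m) (n : ℕ)
    (S : List (Round m) → Prop) : ℝ :=
  M.histMean Xc select n fun h => indicator (S h)

lemma histProb_le_add {n : ℕ} {P Q S : List (Round m) → Prop}
    (hP : ∀ h, IsRun Xc select h → P h → Q h ∨ S h) : M.histProb Xc select n P ≤
      M.histProb Xc select n Q + M.histProb Xc select n S := by
  unfold histProb
  rw [← M.histMean_add]
  exact M.histMean_mono fun h hr _ => indicator_le_add (hP h hr)

/-- The term of the chosen cell does not grow in mean, and it starts from one if the cell is new. -/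
lemma histMean_potential_le {g : Round m → ℝ}
    (hg : ∀ h, IsRun Xc select h → M.roundMean Xc (select h) (fun r => Real.exp (g r)) ≤ 1)
    (n : ℕ) : M.histMean Xc select n (potential g) ≤ n := by
  induction n with
  | zero => simp [histMean, potential, playedCells]
  | succ n ih =>
    have hstep : M.histMean Xc select (n + 1) (potential g) ≤
        M.histMean Xc select n (fun h => potential g h + 1) := by
      rw [histMean]
      refine M.histMean_mono fun h hr _ => ?_
      set D := ∑ C ∈ (playedCells h).erase (select h), Real.exp ((plays h C).map g).sum
      set B := Real.exp ((plays h (select h)).map g).sum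
      calc M.roundMean Xc (select h) (fun r => potential g (r :: h))
          ≤ M.roundMean Xc (select h) (fun r => B * Real.exp (g r) + D) :=
            M.roundMean_mono fun p => (potential_cons g _ h).le
        _ = B * M.roundMean Xc (select h) (fun r => Real.exp (g r)) + D := by
            rw [M.roundMean_add _ fun _ => D, M.roundMean_const_mul, M.roundMean_const]
        _ ≤ B * 1 + D := by
            have : 0 ≤ B := (Real.exp_pos _).le
            have := mul_le_mul_of_nonneg_left (hg h hr) this
            linarith
        _ ≤ potential g h + 1 := by
            rw [mul_one]
            exact exp_add_sum_erase_le g h (select h)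
    rw [M.histMean_add, M.histMean_const] at hstep
    push_cast
    linarith

/-- Hoeffding's bound for a statistic of all chosen cells: Markov's inequality for the potential,
summed over the number of rounds and the sign of the deviation. -/
lemma histProb_deviates_le {T n : ℕ} (hT : 1 < T) (hn : n ≤ T) {R : ℝ} (hR : 0 < R)
    {A : Round m → Prop} {φ : Round m → ℝ}
    (hφ : ∀ h, IsRun Xc select h → ∀ t,
      M.roundMean Xc (select h) (fun r => Real.exp (hoeffdingExponent R A φ t r)) ≤ 1) :
    M.histProb Xc select n (Deviates T R A φ) ≤ 2 * n / T ^ 3 := by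
  have hT0 : (0 : ℝ) < T := by exact_mod_cast (zero_lt_one.trans hT)
  set g : ℕ → ℝ → Round m → ℝ := fun k s =>
    hoeffdingExponent R A φ (s * (4 * Real.sqrt (2 * k * Real.log T) / (k * R))) with hg
  calc M.histProb Xc select n (Deviates T R A φ)
      ≤ M.histMean Xc select n fun h => ∑ k ∈ Finset.Icc 1 T, ∑ s ∈ ({1, -1} : Finset ℝ),
          1 / (T : ℝ) ^ 4 * potential (g k s) h := by
        refine M.histMean_mono fun h _ hl => ?_
        have hnn : ∀ k s, 0 ≤ 1 / (T : ℝ) ^ 4 * potential (g k s) h := fun k s =>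
          mul_nonneg (by positivity) (potential_nonneg _ _)
        by_cases hd : Deviates T R A φ h
        · rw [indicator_of hd]
          obtain ⟨k, hk, s, hs, hle⟩ := hd.exists_potential hT hR (hl.le.trans hn)
          have h1 : (1 : ℝ) ≤ 1 / (T : ℝ) ^ 4 * potential (g k s) h := by
            rw [div_mul_eq_mul_div, one_mul, le_div_iff₀ (by positivity), one_mul]
            exact hle
          refine h1.trans ((Finset.single_le_sum (f := fun s => 1 / (T : ℝ) ^ 4 *
            potential (g k s) h) (fun s _ => hnn k s) hs).trans ?_)
          exact Finset.single_le_sum (f := fun k => ∑ s ∈ ({1, -1} : Finset ℝ), 1 / (T : ℝ) ^ 4 *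
            potential (g k s) h) (fun k _ => Finset.sum_nonneg fun s _ => hnn k s) hk
        · rw [indicator_of_not hd]
          exact Finset.sum_nonneg fun k _ => Finset.sum_nonneg fun s _ => hnn k s
    _ ≤ ∑ k ∈ Finset.Icc 1 T, ∑ s ∈ ({1, -1} : Finset ℝ), 1 / (T : ℝ) ^ 4 * n := by
        rw [M.histMean_sum]
        refine Finset.sum_le_sum fun k _ => ?_
        rw [M.histMean_sum]
        refine Finset.sum_le_sum fun s _ => ?_
        rw [M.histMean_const_mul]
        exact mul_le_mul_of_nonneg_left (M.histMean_potential_le (fun h hr => hφ h hr _) n)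
          (by positivity)
    _ = 2 * n / T ^ 3 := by
        have hc : ({1, -1} : Finset ℝ).card = 2 := Finset.card_pair (by norm_num)
        simp only [Finset.sum_const, Nat.card_Icc, Nat.add_sub_cancel, nsmul_eq_mul, hc]
        field_simp
        ring

end Market

end

/-! ### Tail bounds for the statistics of the algorithm -/

section

open Classical

variable {m : ℕ} {E : Type u} {Θ : Type v} [MeasurableSpace Θ]

/-- The standing assumptions on the instance, the candidate set, the horizon and the algorithm. -/
structure Setting (M : Market m E Θ) (Xc : Set (Fin m → ℝ)) (c : ℝ) (T : ℕ)
    (select : List (Round m) → Cell m) : Prop where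
  fosd : M.FOSD
  ties : M.ConsistentTies
  bounded : Xc ⊆ boundedMonotone m
  nonempty : Xc.Nonempty
  rule : IsSelectionRule M.value Xc c T select
  one_le : 1 ≤ m
  le_conf : 16 * (m : ℝ) ^ 2 ≤ c
  le_horizon : 18 ≤ T

variable {M : Market m E Θ} {Xc : Set (Fin m → ℝ)} {c : ℝ} {T : ℕ}
  {select : List (Round m) → Cell m} {h : List (Round m)} {C : Cell m}

namespace Setting

lemma one_le_cast (S : Setting M Xc c T select) : (1 : ℝ) ≤ m := by exact_mod_cast S.one_le

lemma one_lt (S : Setting M Xc c T select) : 1 < T := lt_of_lt_of_le (by norm_num) S.le_horizon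

lemma one_le_log (S : Setting M Xc c T select) : 1 ≤ Real.log T := by
  have h18 : (18 : ℝ) ≤ T := by exact_mod_cast S.le_horizon
  rw [Real.le_log_iff_exp_le (by linarith)]
  linarith [Real.exp_one_lt_d9]

lemma active_feasible (S : Setting M Xc c T select) (hr : IsRun Xc select h) :
    ∀ C ∈ active M.value Xc c T h, Cell.Feasible Xc C ∧ C.Relevant Xc := by
  induction hr with
  | nil =>
    rintro C rfl
    refine ⟨.root, ?_⟩
    obtain ⟨x, hx⟩ := S.nonempty
    exact ⟨x, Cell.weaklyBounded_eq_root m ▸ boundedMonotone_subset (S.bounded hx), hx⟩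
  | @cons h p hr ih =>
    intro C hC
    rw [active] at hC
    split_ifs at hC with hz
    · rcases hC.1 with hC | ⟨hQ, hR⟩
      · exact ih C hC
      · exact ⟨.quadrant (ih _ (S.rule h).1).1 hQ hR, hR⟩
    · exact ih C hC

lemma select_feasible (S : Setting M Xc c T select) (hr : IsRun Xc select h) :
    Cell.Feasible Xc (select h) ∧ (select h).Relevant Xc :=
  S.active_feasible hr _ (S.rule h).1

end Setting

/-- A deviation of the average gain of a cell. -/
def gainDeviation (M : Market m E Θ) (Xc : Set (Fin m → ℝ)) (r : Round m) : ℝ :=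
  r.gain M.value - M.cellUtility Xc r.cell

/-- A deviation of the number of rounds in which the maximal corner is posted. -/
def cornerDeviation (r : Round m) : ℝ := (if r.contract = r.cell.hi then 1 else 0) - 1 / 2

/-- A deviation of value plus payment; the estimated width is the difference of the averages of
this sum over the two anchors. -/
def totalDeviation (M : Market m E Θ) (r : Round m) : ℝ :=
  (M.value r.outcome + pay r.contract r.outcome) - (M.expValue r.contract + M.expPay r.contract)

/-- The rounds of composite cells in which the anchor with number `b` is posted. -/
def PostsAnchor (Xc : Set (Fin m → ℝ)) (b : Bool) (r : Round m) : Prop :=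
  r.cell.Composite Xc ∧ r.contract = r.cell.anchor Xc b

lemma Cell.Composite.anchor_injective (hC : C.Composite Xc) :
    Function.Injective (C.anchor Xc) := by
  have := hC.hi_ne_lo
  intro a b hab
  cases a <;> cases b <;> simp_all [Cell.anchor_true, Cell.anchor_false, eq_comm]

lemma roundMean_exp_hoeffding_le {R a b : ℝ} {A : Round m → Prop} {φ : Round m → ℝ}
    (hA : ∀ p, A (roundAt Xc C p)) (hφ : ∀ p, φ (roundAt Xc C p) ∈ Set.Icc a b) (hR : b - a = R)
    (hmean : M.roundMean Xc C φ = 0) (t : ℝ) :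
    M.roundMean Xc C (fun r => Real.exp (hoeffdingExponent R A φ t r)) ≤ 1 := by
  have h1 := sum_mul_exp_le_of_mem_Icc (fun p => M.roundWeight_nonneg (Xc := Xc) (C := C) p)
    M.roundWeight_sum hφ hmean t
  have h2 : M.roundMean Xc C (fun r => Real.exp (hoeffdingExponent R A φ t r)) =
      Real.exp (-(t ^ 2 * R ^ 2 / 8)) *
        ∑ p, M.roundWeight Xc C p * Real.exp (t * φ (roundAt Xc C p)) := by
    unfold Market.roundMean
    rw [Finset.mul_sum]
    refine Finset.sum_congr rfl fun p _ => ?_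
    have h3 : hoeffdingExponent R A φ t (roundAt Xc C p) =
        t * φ (roundAt Xc C p) + -(t ^ 2 * R ^ 2 / 8) := by
      rw [hoeffdingExponent, if_pos (hA p), sub_eq_add_neg]
    simp only [h3, Real.exp_add]
    ring
  rw [h2]
  calc _ ≤ Real.exp (-(t ^ 2 * R ^ 2 / 8)) * Real.exp (t ^ 2 * (b - a) ^ 2 / 8) :=
        mul_le_mul_of_nonneg_left h1 (Real.exp_pos _).le
    _ = 1 := by rw [← Real.exp_add, hR, neg_add_cancel, Real.exp_zero]

lemma roundMean_exp_hoeffding_of_not {R : ℝ} {A : Round m → Prop} {φ : Round m → ℝ}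
    (hA : ∀ p, ¬ A (roundAt Xc C p)) (t : ℝ) :
    M.roundMean Xc C (fun r => Real.exp (hoeffdingExponent R A φ t r)) ≤ 1 := by
  refine (M.roundMean_mono fun p => ?_).trans (M.roundMean_const (Xc := Xc) (C := C) 1).le
  rw [hoeffdingExponent, if_neg (hA p), Real.exp_zero]

lemma anchor_weaklyBounded (hC : Cell.Feasible Xc C) (hR : C.Relevant Xc) (b : Bool) :
    C.anchor Xc b ∈ weaklyBounded m :=
  hC.toSet_subset ((hC.anchor_mem b).resolve_right (not_not.2 hR))

lemma roundMean_exp_gainDeviation (hC : Cell.Feasible Xc C) (hR : C.Relevant Xc) (t : ℝ) :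
    M.roundMean Xc C (fun r => Real.exp
      (hoeffdingExponent (m + 1) (fun _ => True) (gainDeviation M Xc) t r)) ≤ 1 := by
  refine roundMean_exp_hoeffding_le (a := -m - M.cellUtility Xc C) (b := 1 - M.cellUtility Xc C)
    (fun _ => trivial) (fun p => ?_) (by ring) ?_ t
  · have hw := anchor_weaklyBounded hC hR p.1
    have h1 := M.value_nonneg p.2
    have h2 := M.value_le_one p.2
    have h3 := pay_nonneg hw p.2
    have h4 := pay_le hw p.2
    simp only [gainDeviation, roundAt, Round.gain, Set.mem_Icc]
    constructor <;> linarith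
  · have h1 : M.roundMean Xc C (gainDeviation M Xc) =
        M.roundMean Xc C (fun r => r.gain M.value + -M.cellUtility Xc C) :=
      Finset.sum_congr rfl fun p _ => by simp [gainDeviation, roundAt, sub_eq_add_neg]
    rw [h1, M.roundMean_add _ fun _ => -M.cellUtility Xc C, M.roundMean_const, M.roundMean_gain]
    ring

lemma roundMean_exp_cornerDeviation (t : ℝ) :
    M.roundMean Xc C (fun r => Real.exp
      (hoeffdingExponent 1 (fun r => r.cell.Composite Xc) cornerDeviation t r)) ≤ 1 := by
  by_cases hC : C.Composite Xc
  · refine roundMean_exp_hoeffding_le (a := -(1 / 2)) (b := 1 / 2)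
      (fun _ => hC) (fun p => ?_) (by ring) ?_ t
    · simp only [cornerDeviation, Set.mem_Icc]
      split_ifs <;> norm_num
    · unfold Market.roundMean
      rw [Fintype.sum_prod_type, Fintype.sum_bool]
      simp only [Market.roundWeight, roundAt, cornerDeviation, Cell.anchor_true hC,
        Cell.anchor_false hC, if_neg hC.hi_ne_lo.symm, if_true]
      simp only [← Finset.sum_mul, ← Finset.sum_div, M.outcomeLaw_sum]
      norm_num
  · exact roundMean_exp_hoeffding_of_not (fun _ => hC) t

lemma sum_outcomeLaw_exp_totalDeviation {x : Fin m → ℝ} (hx : x ∈ weaklyBounded m) (C : Cell m)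
    (t : ℝ) : ∑ o, (M.outcomeLaw x o).toReal *
      Real.exp (t * totalDeviation M ⟨C, x, o⟩) ≤ Real.exp (t ^ 2 * (m + 1) ^ 2 / 8) := by
  have h1 := sum_mul_exp_le_of_mem_Icc (p := fun o => (M.outcomeLaw x o).toReal)
    (y := fun o => totalDeviation M ⟨C, x, o⟩)
    (a := -(M.expValue x + M.expPay x)) (b := m + 1 - (M.expValue x + M.expPay x))
    (fun _ => ENNReal.toReal_nonneg) (M.outcomeLaw_sum x) (fun o => ?_) ?_ t
  · refine h1.trans (le_of_eq ?_)
    congr 1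
    ring
  · have h1 := M.value_nonneg o
    have h2 := M.value_le_one o
    have h3 := pay_nonneg hx o
    have h4 := pay_le hx o
    simp only [totalDeviation, Set.mem_Icc]
    constructor <;> linarith
  · simp only [totalDeviation, mul_sub, mul_add, Finset.sum_sub_distrib, Finset.sum_add_distrib,
      ← Finset.sum_mul, M.outcomeLaw_sum, one_mul]
    exact sub_self _

lemma roundMean_exp_totalDeviation (hC : Cell.Feasible Xc C) (hR : C.Relevant Xc) (b : Bool)
    (t : ℝ) : M.roundMean Xc C (fun r => Real.exp
      (hoeffdingExponent (m + 1) (PostsAnchor Xc b) (totalDeviation M) t r)) ≤ 1 := by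
  by_cases hcomp : C.Composite Xc
  · have key : ∀ b', ∑ o, M.roundWeight Xc C (b', o) * Real.exp (hoeffdingExponent (m + 1)
        (PostsAnchor Xc b) (totalDeviation M) t (roundAt Xc C (b', o))) ≤ 1 / 2 := by
      intro b'
      by_cases hb : b' = b
      · subst hb
        have h1 := sum_outcomeLaw_exp_totalDeviation (M := M)
          (anchor_weaklyBounded hC hR b') C t
        have h2 : ∀ o, M.roundWeight Xc C (b', o) * Real.exp (hoeffdingExponent (m + 1)
            (PostsAnchor Xc b') (totalDeviation M) t (roundAt Xc C (b', o))) =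
            Real.exp (-(t ^ 2 * (m + 1) ^ 2 / 8)) / 2 *
              ((M.outcomeLaw (C.anchor Xc b') o).toReal *
                Real.exp (t * totalDeviation M ⟨C, C.anchor Xc b', o⟩)) := by
          intro o
          rw [hoeffdingExponent, if_pos ⟨hcomp, rfl⟩, sub_eq_add_neg, Real.exp_add]
          simp only [Market.roundWeight, roundAt]
          ring
        rw [Finset.sum_congr rfl fun o _ => h2 o, ← Finset.mul_sum]
        calc _ ≤ Real.exp (-(t ^ 2 * (m + 1) ^ 2 / 8)) / 2 *
              Real.exp (t ^ 2 * (m + 1) ^ 2 / 8) := mul_le_mul_of_nonneg_left h1 (by positivity)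
          _ = 1 / 2 := by rw [div_mul_eq_mul_div, ← Real.exp_add, neg_add_cancel, Real.exp_zero]
      · have h2 : ∀ o, M.roundWeight Xc C (b', o) * Real.exp (hoeffdingExponent (m + 1)
            (PostsAnchor Xc b) (totalDeviation M) t (roundAt Xc C (b', o))) =
            (M.outcomeLaw (C.anchor Xc b') o).toReal / 2 := by
          intro o
          rw [hoeffdingExponent, if_neg fun hp => hb (hcomp.anchor_injective hp.2), Real.exp_zero,
            mul_one]
          rfl
        rw [Finset.sum_congr rfl fun o _ => h2 o, ← Finset.sum_div, M.outcomeLaw_sum]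
    unfold Market.roundMean
    rw [Fintype.sum_prod_type, Fintype.sum_bool]
    linarith [key true, key false]
  · exact roundMean_exp_hoeffding_of_not (fun _ hp => hcomp hp.1) t

/-- None of the four statistics of the chosen cells deviates. -/
def Typical (M : Market m E Θ) (Xc : Set (Fin m → ℝ)) (T : ℕ) (h : List (Round m)) : Prop :=
  ¬ Deviates T (m + 1) (fun _ => True) (gainDeviation M Xc) h ∧
  ¬ Deviates T 1 (fun r => r.cell.Composite Xc) cornerDeviation h ∧
  ∀ b, ¬ Deviates T (m + 1) (PostsAnchor Xc b) (totalDeviation M) h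

lemma Setting.histProb_not_typical_le (S : Setting M Xc c T select) {n : ℕ} (hn : n ≤ T) :
    M.histProb Xc select n (fun h => ¬ Typical M Xc T h) ≤ 8 / (T : ℝ) ^ 2 := by
  have hT0 : (0 : ℝ) < T := by exact_mod_cast zero_lt_one.trans S.one_lt
  have h1 := M.histProb_deviates_le (Xc := Xc) (select := select) S.one_lt hn
    (R := m + 1) (by positivity)
    fun h hr t => roundMean_exp_gainDeviation (S.select_feasible hr).1 (S.select_feasible hr).2 t
  have h2 := M.histProb_deviates_le (Xc := Xc) (select := select) S.one_lt hn
    (R := 1) (by positivity) fun h hr t => roundMean_exp_cornerDeviation t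
  have h3 := fun b => M.histProb_deviates_le (Xc := Xc) (select := select) S.one_lt hn
    (R := m + 1) (by positivity) fun h hr t =>
      roundMean_exp_totalDeviation (S.select_feasible hr).1 (S.select_feasible hr).2 b t
  have h4 : M.histProb Xc select n (fun h => ¬ Typical M Xc T h) ≤
      M.histProb Xc select n (Deviates T (m + 1) (fun _ => True) (gainDeviation M Xc)) +
      (M.histProb Xc select n (Deviates T 1 (fun r => r.cell.Composite Xc) cornerDeviation) +
      (M.histProb Xc select n (Deviates T (m + 1) (PostsAnchor Xc true) (totalDeviation M)) +
      M.histProb Xc select n (Deviates T (m + 1) (PostsAnchor Xc false) (totalDeviation M)))) := by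
    refine (M.histProb_le_add fun h _ ht => ?_).trans (add_le_add_right
      ((M.histProb_le_add fun h _ ht => ht).trans (add_le_add_right
        (M.histProb_le_add fun h _ ht => ht) _)) _)
    simp only [Typical, Bool.forall_bool] at ht
    tauto
  have h5 : 2 * (n : ℝ) / T ^ 3 ≤ 2 / T ^ 2 := by
    rw [div_le_div_iff₀ (by positivity) (by positivity)]
    have : (n : ℝ) ≤ T := by exact_mod_cast hn
    have h6 := mul_le_mul_of_nonneg_right this (show (0 : ℝ) ≤ 2 * T ^ 2 by positivity)
    linarith
  have h6 : 8 / (T : ℝ) ^ 2 = 4 * (2 / T ^ 2) := by ring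
  linarith [h3 true, h3 false]

end

/-! ### Accuracy of the estimates -/

section

open Classical

variable {m : ℕ} {E : Type u} {Θ : Type v} [MeasurableSpace Θ]
variable {M : Market m E Θ} {Xc : Set (Fin m → ℝ)} {c : ℝ} {T : ℕ}
  {select : List (Round m) → Cell m} {h : List (Round m)} {C : Cell m}

lemma sum_map_sub_const {α : Type*} (a : ℝ) (f : α → ℝ) (l : List α) :
    (l.map fun r => f r - a).sum = (l.map f).sum - l.length * a := by
  induction l with
  | nil => simp
  | cons r l ih => simp only [List.map_cons, List.sum_cons, ih, List.length_cons]; push_cast; ring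

lemma avg_mem {l : List (Round m)} {g : Round m → ℝ} {a : ℝ} (ha : 0 ≤ a)
    (hg : ∀ r ∈ l, g r ∈ Set.Icc 0 a) : avg l g ∈ Set.Icc 0 a := by
  have h0 : 0 ≤ (l.map g).sum := List.sum_nonneg fun x hx => by
    obtain ⟨r, hr, rfl⟩ := List.mem_map.1 hx
    exact (hg r hr).1
  have h1 : (l.map g).sum ≤ l.length * a := by
    have := List.sum_le_card_nsmul (l.map g) a fun x hx => by
      obtain ⟨r, hr, rfl⟩ := List.mem_map.1 hx
      exact (hg r hr).2
    simpa using this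
  unfold avg
  exact ⟨div_nonneg h0 (Nat.cast_nonneg _),
    div_le_of_le_mul₀ (Nat.cast_nonneg _) ha (by rwa [mul_comm])⟩

lemma avg_add (l : List (Round m)) (f g : Round m → ℝ) :
    avg l (fun r => f r + g r) = avg l f + avg l g := by
  unfold avg
  rw [List.sum_map_add, add_div]

/-- A sum of deviations within the confidence bound, as a bound for the average. -/
lemma abs_avg_sub_le {l : List (Round m)} {g : Round m → ℝ} {u R L : ℝ} (hl : l ≠ [])
    (h : |(l.map fun r => g r - u).sum| < R * Real.sqrt (2 * l.length * L)) :
    |avg l g - u| ≤ R * Real.sqrt (2 * L / l.length) := by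
  have hk : (0 : ℝ) < l.length := by exact_mod_cast List.length_pos_iff.2 hl
  have h1 : avg l g - u = (l.map fun r => g r - u).sum / l.length := by
    rw [sum_map_sub_const]
    unfold avg
    field_simp
  have h2 : Real.sqrt (2 * L / l.length) = Real.sqrt (2 * l.length * L) / l.length := by
    have : 2 * L / l.length = 2 * l.length * L / (l.length : ℝ) ^ 2 := by field_simp
    rw [this, Real.sqrt_div' _ (by positivity), Real.sqrt_sq hk.le]
  rw [h1, abs_div, abs_of_pos hk, h2, ← mul_div_assoc]
  exact div_le_div_of_nonneg_right h.le hk.le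

/-- The estimates for `C` are within the confidence radius. -/
def Accurate (M : Market m E Θ) (Xc : Set (Fin m → ℝ)) (c : ℝ) (T : ℕ)
    (h : List (Round m)) (C : Cell m) : Prop :=
  |estUtility M.value h C - M.cellUtility Xc C| ≤ radius c T h C ∧
    (C.Composite Xc → |estWidth M.value h C - M.virtualWidth C| ≤ 4 * radius c T h C)

lemma filter_postsAnchor (hC : C.Composite Xc) (b : Bool) :
    (plays h C).filter (PostsAnchor Xc b) = playsWith h C (C.anchor Xc b) := by
  unfold plays playsWith
  rw [List.filter_filter]
  refine List.filter_congr fun r _ => ?_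
  by_cases hr : r.cell = C
  · subst hr
    simp [PostsAnchor, hC]
  · simp [hr]

lemma mem_plays {r : Round m} : r ∈ plays h C ↔ r ∈ h ∧ r.cell = C := by
  simp [plays]

lemma mem_playsWith {x : Fin m → ℝ} {r : Round m} :
    r ∈ playsWith h C x ↔ r ∈ h ∧ r.cell = C ∧ r.contract = x := by
  simp [playsWith]

lemma estWidth_eq (hC : C.Composite Xc) :
    estWidth M.value h C =
      avg (playsWith h C (C.anchor Xc true)) (fun r => M.value r.outcome + pay r.contract r.outcome)
      - avg (playsWith h C (C.anchor Xc false))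
          (fun r => M.value r.outcome + pay r.contract r.outcome) := by
  rw [Cell.anchor_true hC, Cell.anchor_false hC, avg_add, avg_add]
  unfold estWidth
  ring

/-- After each of the rounds, the estimates of all chosen cells are accurate. -/
def Clean (M : Market m E Θ) (Xc : Set (Fin m → ℝ)) (c : ℝ) (T : ℕ) :
    List (Round m) → Prop
  | [] => True
  | r :: h => Clean M Xc c T h ∧ ∀ C ∈ playedCells (r :: h), Accurate M Xc c T (r :: h) C

namespace Setting

lemma round_of_mem (S : Setting M Xc c T select) (hr : IsRun Xc select h) :
    ∀ r ∈ h, (Cell.Feasible Xc r.cell ∧ r.cell.Relevant Xc) ∧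
      ∃ p, r = roundAt Xc r.cell p := by
  induction hr with
  | nil => simp
  | cons p hr ih =>
    intro r hmem
    rcases List.mem_cons.1 hmem with rfl | hmem
    · exact ⟨S.select_feasible hr, p, rfl⟩
    · exact ih r hmem

lemma contract_mem (S : Setting M Xc c T select) (hr : IsRun Xc select h) {r : Round m}
    (hmem : r ∈ h) : r.contract ∈ weaklyBounded m := by
  obtain ⟨⟨h1, h2⟩, p, hp⟩ := S.round_of_mem hr r hmem
  rw [hp]
  exact anchor_weaklyBounded h1 h2 _

lemma feasible_of_mem_playedCells (S : Setting M Xc c T select) (hr : IsRun Xc select h)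
    (hC : C ∈ playedCells h) : Cell.Feasible Xc C ∧ C.Relevant Xc := by
  simp only [playedCells, List.mem_toFinset, List.mem_map] at hC
  obtain ⟨r, hmem, rfl⟩ := hC
  exact (S.round_of_mem hr r hmem).1

lemma four_mul_sq_le (S : Setting M Xc c T select) : 4 * (m + 1 : ℝ) ^ 2 ≤ c := by
  have h1 := S.one_le_cast
  refine le_trans ?_ S.le_conf
  nlinarith

lemma conf_pos (S : Setting M Xc c T select) : 0 < c := by
  have := S.one_le_cast
  have := S.le_conf
  nlinarith

/-- Comparison of a confidence bound after `k` of `n` rounds with the confidence radius. -/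
lemma mul_sqrt_le_radius (S : Setting M Xc c T select) {k a : ℝ} (hk : 0 < k) (ha : 0 ≤ a)
    (hne : plays h C ≠ []) (hn : ((plays h C).length : ℝ) ≤ 2 * a ^ 2 * k) :
    (m + 1) * Real.sqrt (2 * Real.log T / k) ≤ a * radius c T h C := by
  have hL := S.one_le_log
  have hc := S.conf_pos
  unfold radius
  have hn0 : (0 : ℝ) < (plays h C).length := by exact_mod_cast List.length_pos_iff.2 hne
  have hm : (m + 1 : ℝ) ^ 2 * 4 ≤ c := by
    have := S.four_mul_sq_le
    linarith
  have e1 : (m + 1 : ℝ) * Real.sqrt (2 * Real.log T / k) =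
      Real.sqrt ((m + 1) ^ 2 * (2 * Real.log T / k)) := by
    rw [Real.sqrt_mul (by positivity), Real.sqrt_sq (by positivity)]
  have e2 : a * Real.sqrt (c * Real.log T / (plays h C).length) =
      Real.sqrt (a ^ 2 * (c * Real.log T / (plays h C).length)) := by
    rw [Real.sqrt_mul (by positivity), Real.sqrt_sq ha]
  rw [e1, e2]
  refine Real.sqrt_le_sqrt ?_
  rw [← mul_div_assoc, ← mul_div_assoc, div_le_div_iff₀ hk hn0]
  calc (m + 1 : ℝ) ^ 2 * (2 * Real.log T) * (plays h C).length
      ≤ (m + 1 : ℝ) ^ 2 * (2 * Real.log T) * (2 * a ^ 2 * k) :=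
        mul_le_mul_of_nonneg_left hn (by positivity)
    _ = ((m + 1 : ℝ) ^ 2 * 4) * (a ^ 2 * Real.log T * k) := by ring
    _ ≤ c * (a ^ 2 * Real.log T * k) := mul_le_mul_of_nonneg_right hm (by positivity)
    _ = a ^ 2 * (c * Real.log T) * k := by ring

lemma estUtility_accurate (S : Setting M Xc c T select) (hC : C ∈ playedCells h)
    (ht : Typical M Xc T h) :
    |estUtility M.value h C - M.cellUtility Xc C| ≤ radius c T h C := by
  have hne := mem_playedCells.1 hC
  have hd := ht.1
  unfold Deviates at hd
  push Not at hd
  have h1 := hd C (by rw [List.filter_eq_self.2 fun r _ => by simp]; exact hne)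
  rw [List.filter_eq_self.2 fun r _ => by simp] at h1
  have h2 : (plays h C).map (gainDeviation M Xc) =
      (plays h C).map fun r => r.gain M.value - M.cellUtility Xc C :=
    List.map_congr_left fun r hr => by rw [gainDeviation, (mem_plays.1 hr).2]
  rw [h2] at h1
  have hk : (0 : ℝ) < (plays h C).length := by exact_mod_cast List.length_pos_iff.2 hne
  have h3 := S.mul_sqrt_le_radius (h := h) (C := C) hk zero_le_one hne (by linarith)
  rw [one_mul] at h3
  exact (abs_avg_sub_le hne h1).trans h3

/-- Each anchor of a composite cell is posted in more than an eighth of its rounds, once the number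
of rounds exceeds `16 log T`. -/
lemma corner_count (hCc : C.Composite Xc) (hC : C ∈ playedCells h)
    (ht : Typical M Xc T h) (b : Bool) (hr : IsRun Xc select h) (S : Setting M Xc c T select)
    (hn : 16 * Real.log T < (plays h C).length) :
    ((plays h C).length : ℝ) < 8 * (playsWith h C (C.anchor Xc b)).length := by
  have hne := mem_playedCells.1 hC
  have hL := S.one_le_log
  set n : ℝ := ((plays h C).length : ℝ) with hn_def
  have hn0 : 0 < n := by linarith
  have hd := ht.2.1
  unfold Deviates at hd
  push Not at hd
  have hf : (plays h C).filter (fun r => r.cell.Composite Xc) = plays h C :=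
    List.filter_eq_self.2 fun r hr => by simpa [(mem_plays.1 hr).2] using hCc
  have h1 := hd C (by rw [hf]; exact hne)
  rw [hf, one_mul] at h1
  have h2 : Real.sqrt (2 * (plays h C).length * Real.log T) ≤ 3 / 8 * n := by
    rw [← hn_def]
    refine Real.sqrt_le_iff.2 ⟨by positivity, ?_⟩
    -- `2 * log T ≤ n / 8` and `1 / 8 ≤ (3 / 8) ^ 2`.
    nlinarith
  have h3 : ∀ l : List (Round m), (∀ r ∈ l, r.cell = C ∧ ∃ p, r = roundAt Xc C p) →
      (l.map cornerDeviation).sum =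
        ((l.filter fun r => r.cell = C ∧ r.contract = C.anchor Xc true).length : ℝ)
          - l.length / 2 ∧
      (l.map cornerDeviation).sum =
        l.length / 2 -
          ((l.filter fun r => r.cell = C ∧ r.contract = C.anchor Xc false).length : ℝ) := by
    intro l
    induction l with
    | nil => simp
    | cons r l ih =>
      intro hl
      obtain ⟨hrC, p, hp⟩ := hl r (List.mem_cons_self ..)
      obtain ⟨i1, i2⟩ := ih fun r hr => hl r (List.mem_cons_of_mem _ hr)
      simp only [List.map_cons, List.sum_cons, List.length_cons]
      have hinj := hCc.anchor_injective
      have hcon : r.contract = C.anchor Xc p.1 := by rw [hp]; rfl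
      have hval : cornerDeviation r = if p.1 = true then 1 / 2 else -(1 / 2) := by
        rw [cornerDeviation, hrC, hcon, ← Cell.anchor_true hCc]
        simp only [hinj.eq_iff]
        split_ifs <;> norm_num
      rw [hval]
      cases hb : p.1
      · rw [List.filter_cons_of_neg (by simp [hrC, hcon, hinj.eq_iff, hb]),
          List.filter_cons_of_pos (by simp [hrC, hcon, hb])]
        simp only [List.length_cons]
        push_cast
        constructor
        · rw [i1]; simp; ring
        · rw [i2]; simp; ring
      · rw [List.filter_cons_of_pos (by simp [hrC, hcon, hb]),
          List.filter_cons_of_neg (by simp [hrC, hcon, hinj.eq_iff, hb])]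
        simp only [List.length_cons]
        push_cast
        constructor
        · rw [i1]; simp; ring
        · rw [i2]; simp; ring
  have h4 := h3 (plays h C) fun r hmem => by
    obtain ⟨hm, rfl⟩ := mem_plays.1 hmem
    exact ⟨rfl, (S.round_of_mem hr r hm).2⟩
  have h5 : ∀ b, (plays h C).filter (fun r => r.cell = C ∧ r.contract = C.anchor Xc b) =
      playsWith h C (C.anchor Xc b) := by
    intro b
    unfold plays playsWith
    rw [List.filter_filter]
    refine List.filter_congr fun r _ => ?_
    by_cases hr : r.cell = C <;> simp [hr]
  rw [h5, h5] at h4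
  have h6 := abs_lt.1 (h1.trans_le h2)
  rw [← hn_def] at h4
  cases b
  · rw [h4.2] at h6
    linarith [h6.2]
  · rw [h4.1] at h6
    linarith [h6.1]

lemma avg_total_mem (S : Setting M Xc c T select) (hr : IsRun Xc select h) (x : Fin m → ℝ) :
    avg (playsWith h C x) (fun r => M.value r.outcome + pay r.contract r.outcome) ∈
      Set.Icc (0 : ℝ) (m + 1) := by
  refine avg_mem (by positivity) fun r hmem => ?_
  have hw := S.contract_mem hr (mem_playsWith.1 hmem).1
  have h1 := M.value_nonneg r.outcome
  have h2 := M.value_le_one r.outcome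
  have h3 := pay_nonneg hw r.outcome
  have h4 := pay_le hw r.outcome
  constructor <;> linarith

lemma estWidth_accurate (S : Setting M Xc c T select) (hr : IsRun Xc select h)
    (hC : C ∈ playedCells h) (ht : Typical M Xc T h) (hCc : C.Composite Xc) :
    |estWidth M.value h C - M.virtualWidth C| ≤ 4 * radius c T h C := by
  have hne := mem_playedCells.1 hC
  have hk : (0 : ℝ) < (plays h C).length := by exact_mod_cast List.length_pos_iff.2 hne
  have hm := S.one_le_cast
  have hL := S.one_le_log
  rw [estWidth_eq hCc]
  rcases le_or_gt ((plays h C).length : ℝ) (16 * Real.log T) with hn | hn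
  · -- The confidence radius exceeds `m`, and the bound holds for all values of the averages.
    have h1 := avg_total_mem (C := C) S hr (C.anchor Xc true)
    have h2 := avg_total_mem (C := C) S hr (C.anchor Xc false)
    have h3 := M.virtualWidth_le (S.feasible_of_mem_playedCells hr hC).1
    have h4 := M.virtualWidth_nonneg S.fosd S.ties (S.feasible_of_mem_playedCells hr hC).1
    have h5 : (m : ℝ) ≤ radius c T h C := by
      refine Real.le_sqrt_of_sq_le ?_
      rw [le_div_iff₀ hk]
      calc (m : ℝ) ^ 2 * (plays h C).length ≤ (m : ℝ) ^ 2 * (16 * Real.log T) :=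
            mul_le_mul_of_nonneg_left hn (by positivity)
        _ = 16 * (m : ℝ) ^ 2 * Real.log T := by ring
        _ ≤ c * Real.log T := mul_le_mul_of_nonneg_right S.le_conf (by linarith)
    rw [abs_le]
    constructor <;> linarith [h1.1, h1.2, h2.1, h2.2]
  · have key : ∀ b, |avg (playsWith h C (C.anchor Xc b))
          (fun r => M.value r.outcome + pay r.contract r.outcome) -
        (M.expValue (C.anchor Xc b) + M.expPay (C.anchor Xc b))| ≤ 2 * radius c T h C := by
      intro b
      have hcount := corner_count hCc hC ht b hr S hn
      have hkb : (0 : ℝ) < (playsWith h C (C.anchor Xc b)).length := by linarith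
      have hneb : playsWith h C (C.anchor Xc b) ≠ [] := fun h0 => by simp [h0] at hkb
      have hd := ht.2.2 b
      unfold Deviates at hd
      push Not at hd
      have h1 := hd C (by rw [filter_postsAnchor hCc]; exact hneb)
      rw [filter_postsAnchor hCc] at h1
      have h2 : (playsWith h C (C.anchor Xc b)).map (totalDeviation M) =
          (playsWith h C (C.anchor Xc b)).map fun r =>
            (M.value r.outcome + pay r.contract r.outcome) -
              (M.expValue (C.anchor Xc b) + M.expPay (C.anchor Xc b)) :=
        List.map_congr_left fun r hmem => by
          rw [totalDeviation]
          congr 2 <;> rw [(mem_playsWith.1 hmem).2.2]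
      rw [h2] at h1
      exact (abs_avg_sub_le hneb h1).trans
        (S.mul_sqrt_le_radius hkb zero_le_two hne (by linarith))
    have h1 := key true
    have h2 := key false
    rw [abs_le] at h1 h2 ⊢
    have h3 : M.virtualWidth C = (M.expValue (C.anchor Xc true) + M.expPay (C.anchor Xc true)) -
        (M.expValue (C.anchor Xc false) + M.expPay (C.anchor Xc false)) := by
      rw [Cell.anchor_true hCc, Cell.anchor_false hCc]
      unfold Market.virtualWidth
      ring
    rw [h3]
    constructor <;> linarith [h1.1, h1.2, h2.1, h2.2]

lemma accurate (S : Setting M Xc c T select) (hr : IsRun Xc select h)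
    (hC : C ∈ playedCells h) (ht : Typical M Xc T h) : Accurate M Xc c T h C :=
  ⟨S.estUtility_accurate hC ht, S.estWidth_accurate hr hC ht⟩

lemma histProb_not_clean_le (S : Setting M Xc c T select) {n : ℕ} (hn : n ≤ T) :
    M.histProb Xc select n (fun h => ¬ Clean M Xc c T h) ≤ n * (8 / (T : ℝ) ^ 2) := by
  induction n with
  | zero => simp [Market.histProb, Market.histMean, Clean, indicator]
  | succ n ih =>
    have h1 : M.histProb Xc select (n + 1) (fun h => ¬ Clean M Xc c T h) ≤
        M.histProb Xc select (n + 1) (fun h => ¬ Clean M Xc c T h.tail) +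
          M.histProb Xc select (n + 1) (fun h => ¬ Typical M Xc T h) := by
      refine M.histProb_le_add fun h hr hnc => ?_
      by_contra hcon
      simp only [not_or, not_not] at hcon
      cases h with
      | nil => exact hnc trivial
      | cons r h => exact hnc ⟨hcon.1, fun C hC => S.accurate hr hC hcon.2⟩
    have h2 : M.histProb Xc select (n + 1) (fun h => ¬ Clean M Xc c T h.tail) =
        M.histProb Xc select n (fun h => ¬ Clean M Xc c T h) :=
      M.histMean_congr fun h _ _ => M.roundMean_const (indicator (¬ Clean M Xc c T h))
    have h3 := S.histProb_not_typical_le hn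
    have h4 := ih (Nat.le_of_succ_le hn)
    rw [h2] at h1
    push_cast
    linarith

end Setting
end

/-! ### The active cells -/

section

open Classical

variable {m : ℕ} {E : Type u} {Θ : Type v} [MeasurableSpace Θ]
variable {M : Market m E Θ} {Xc : Set (Fin m → ℝ)} {c : ℝ} {T : ℕ}
  {select : List (Round m) → Cell m} {h : List (Round m)} {C : Cell m}

lemma playsWith_cons_of_ne {r : Round m} (h : List (Round m)) (hC : r.cell ≠ C)
    (x : Fin m → ℝ) : playsWith (r :: h) C x = playsWith h C x := by
  simp [playsWith, hC]

lemma estWidth_cons_of_ne {r : Round m} (val : Fin (m + 1) → ℝ) (h : List (Round m))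
    (hC : r.cell ≠ C) : estWidth val (r :: h) C = estWidth val h C := by
  unfold estWidth
  simp only [playsWith_cons_of_ne h hC]

lemma radius_cons_of_ne {r : Round m} (h : List (Round m)) (hC : r.cell ≠ C) :
    radius c T (r :: h) C = radius c T h C := by
  unfold radius
  rw [plays_cons_of_ne h hC]

/-- What holds for the active cells at all times. Half-open active cells are disjoint, and none of
them strictly contains a cell that was chosen before; hence the quadrants of an active cell have
not been chosen yet when they become active. -/
structure ActiveInvariant (M : Market m E Θ) (Xc : Set (Fin m → ℝ)) (c : ℝ) (T : ℕ)
    (h : List (Round m)) : Prop where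
  disjoint : ∀ C ∈ active M.value Xc c T h, ∀ D ∈ active M.value Xc c T h,
    ¬ Disjoint C.box D.box → C = D
  side_le : ∀ C ∈ active M.value Xc c T h, ∀ D ∈ playedCells h,
    ¬ Disjoint C.box D.box → C.side ≤ D.side
  cover : ∀ x ∈ Xc, ∃ C ∈ active M.value Xc c T h, x ∈ C.toSet
  width_le : ∀ C ∈ active M.value Xc c T h, C.Composite Xc → C ∈ playedCells h →
    estWidth M.value h C ≤ 5 * radius c T h C

lemma Clean.accurate (hc : Clean M Xc c T h) (hC : C ∈ playedCells h) :
    Accurate M Xc c T h C := by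
  cases h with
  | nil => simp [playedCells] at hC
  | cons r h => exact hc.2 C hC

lemma length_plays_ne_zero (hC : C ∈ playedCells h) : (plays h C).length ≠ 0 := fun h0 =>
  mem_playedCells.1 hC (List.length_eq_zero_iff.1 h0)

lemma radius_nonneg : 0 ≤ radius c T h C := Real.sqrt_nonneg _

/-- A cell that becomes active in a clean history is the root or a quadrant of a composite cell
whose regret per round is of the order of its virtual width. -/
def HasWideParent (M : Market m E Θ) (Xc : Set (Fin m → ℝ)) (C : Cell m) :
    Prop :=
  C = Cell.root m ∨ ∃ D, Cell.Feasible Xc D ∧ D.Composite Xc ∧ C ∈ D.quadrants ∧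
    M.opt Xc - M.cellUtility Xc D ≤ 16 * M.virtualWidth D

namespace Setting

lemma activeInvariant (S : Setting M Xc c T select) (hr : IsRun Xc select h) :
    ActiveInvariant M Xc c T h := by
  induction hr with
  | nil =>
    refine ⟨fun C hC D hD _ => hC.trans hD.symm, fun C _ D hD => by simp [playedCells] at hD,
      fun x hx => ⟨_, rfl, ?_⟩, fun C _ _ hC => by simp [playedCells] at hC⟩
    exact Cell.weaklyBounded_eq_root m ▸ boundedMonotone_subset (S.bounded hx)
  | @cons h p hr ih =>
    set B := select h with hB
    have hBact : B ∈ active M.value Xc c T h := (S.rule h).1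
    have hside : 0 < B.side := (S.select_feasible hr).1.bounds.1
    have hcell : (roundAt Xc B p).cell = B := rfl
    by_cases hz : B.Composite Xc ∧ 5 * radius c T (roundAt Xc B p :: h) B <
        estWidth M.value (roundAt Xc B p :: h) B
    · have hact : active M.value Xc c T (roundAt Xc B p :: h) =
          (active M.value Xc c T h ∪ {Q | Q ∈ B.quadrants ∧ Q.Relevant Xc}) \ {B} := by
        rw [active, hcell, if_pos hz]
      have hsub : ∀ {Q D : Cell m}, Q ∈ B.quadrants → ¬ Disjoint Q.box D.box →
          ¬ Disjoint B.box D.box := fun hQ hd hd' =>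
        hd (hd'.mono_left (Cell.quadrants_box_subset hside.le hQ))
      refine ⟨?_, ?_, ?_, ?_⟩
      · intro C hC D hD hd
        rw [hact] at hC hD
        rcases hC.1 with hC1 | hC1 <;> rcases hD.1 with hD1 | hD1
        · exact ih.disjoint C hC1 D hD1 hd
        · exact absurd (ih.disjoint _ hBact _ hC1 (hsub hD1.1 fun hd' => hd hd'.symm)).symm hC.2
        · exact absurd (ih.disjoint _ hBact _ hD1 (hsub hC1.1 hd)).symm hD.2
        · by_contra hne
          exact hd (Cell.quadrants_disjoint hC1.1 hD1.1 hne)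
      · intro C hC D hD hd
        rw [hact] at hC
        rw [playedCells_cons, hcell, Finset.mem_insert] at hD
        rcases hC.1 with hC1 | hC1 <;> rcases hD with rfl | hD1
        · exact absurd (ih.disjoint _ hC1 _ hBact hd) hC.2
        · exact ih.side_le C hC1 D hD1 hd
        · rw [Cell.quadrants_side hC1.1]
          linarith
        · rw [Cell.quadrants_side hC1.1]
          linarith [ih.side_le _ hBact D hD1 (hsub hC1.1 hd)]
      · intro x hx
        obtain ⟨C, hC, hxC⟩ := ih.cover x hx
        by_cases hCB : C = B
        · subst hCB
          obtain ⟨Q, hQ, hxQ⟩ := Cell.exists_quadrant_mem hxC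
          refine ⟨Q, hact ▸ ⟨Or.inr ⟨hQ, x, hxQ, hx⟩, fun hQB => ?_⟩, hxQ⟩
          have := Cell.quadrants_side hQ
          rw [Set.mem_singleton_iff.1 hQB] at this
          linarith
        · exact ⟨C, hact ▸ ⟨Or.inl hC, hCB⟩, hxC⟩
      · intro C hC hcomp hplay
        rw [hact] at hC
        have hCB : B ≠ C := fun h' => hC.2 h'.symm
        rw [playedCells_cons, hcell, Finset.mem_insert] at hplay
        have hplay' := hplay.resolve_left hCB.symm
        rw [estWidth_cons_of_ne _ h (hcell ▸ hCB), radius_cons_of_ne h (hcell ▸ hCB)]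
        rcases hC.1 with hC1 | hC1
        · exact ih.width_le C hC1 hcomp hplay'
        · have hs := Cell.quadrants_side hC1.1
          have := ih.side_le _ hBact C hplay' (hsub hC1.1 (Set.not_disjoint_iff.2
            ⟨C.lo, Cell.lo_mem_box (by linarith), Cell.lo_mem_box (by linarith)⟩))
          linarith
    · have hact : active M.value Xc c T (roundAt Xc B p :: h) = active M.value Xc c T h := by
        rw [active, hcell, if_neg hz]
      refine ⟨by rw [hact]; exact ih.disjoint, ?_, by rw [hact]; exact ih.cover, ?_⟩
      · intro C hC D hD hd
        rw [hact] at hC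
        rw [playedCells_cons, hcell, Finset.mem_insert] at hD
        rcases hD with rfl | hD
        · rw [ih.disjoint _ hC _ hBact hd]
        · exact ih.side_le C hC D hD hd
      · intro C hC hcomp hplay
        rw [hact] at hC
        by_cases hCB : C = B
        · rw [hCB] at hcomp ⊢
          rw [not_and, not_lt] at hz
          exact hz hcomp
        · rw [playedCells_cons, hcell, Finset.mem_insert] at hplay
          rw [estWidth_cons_of_ne _ h fun h' => hCB (h'.symm.trans hcell),
            radius_cons_of_ne h fun h' => hCB (h'.symm.trans hcell)]
          exact ih.width_le C hC hcomp (hplay.resolve_left hCB)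

/-! ### Regret and width of the chosen cells in a clean history -/

/-- Optimism: an index bounds the utility of all candidates in its cell. -/
lemma utility_le_index (S : Setting M Xc c T select) (hc : Clean M Xc c T h)
    (hr : IsRun Xc select h) (hC : C ∈ active M.value Xc c T h) {x : Fin m → ℝ}
    (hx : x ∈ C.toSet ∩ Xc) : (M.utility x : EReal) ≤ index M.value Xc c T h C := by
  unfold index
  split_ifs with h0 hcomp
  · exact le_top
  all_goals
    rw [EReal.coe_le_coe_iff]
    have hacc := hc.accurate (mem_playedCells.2 fun h' => h0 (by rw [h']; rfl))
    have h1 := abs_le.1 hacc.1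
    obtain ⟨hF, hR⟩ := S.active_feasible hr C hC
  · have h2 := abs_le.1 (hacc.2 hcomp)
    have h3 := M.le_minUtility_add S.fosd S.ties hF hx.1
    have h4 := M.minUtility_le_cellUtility S.fosd S.ties hF hF hR subset_rfl
    linarith [h1.1, h2.1]
  · rw [M.cellUtility_atomic hR hcomp hx] at h1
    linarith [h1.1]

lemma opt_le_of_index_eq (S : Setting M Xc c T select) (hc : Clean M Xc c T h)
    (hr : IsRun Xc select h) {I : ℝ} (hI : index M.value Xc c T h (select h) = I) :
    M.opt Xc ≤ I := by
  refine csSup_le (S.nonempty.image _) ?_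
  rintro _ ⟨x, hx, rfl⟩
  obtain ⟨C, hC, hxC⟩ := (S.activeInvariant hr).cover x hx
  have h1 := S.utility_le_index hc hr hC ⟨hxC, hx⟩
  exact EReal.coe_le_coe_iff.1 (h1.trans (((S.rule h).2 C hC).trans_eq hI))

lemma badness_le_radius (S : Setting M Xc c T select) (hc : Clean M Xc c T h)
    (hr : IsRun Xc select h) (hC : select h ∈ playedCells h) :
    M.badness Xc (select h) ≤ 11 * radius c T h (select h) := by
  have hacc := hc.accurate hC
  have h1 := abs_le.1 hacc.1
  have hrad : 0 ≤ radius c T h (select h) := radius_nonneg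
  by_cases hcomp : (select h).Composite Xc
  · have h2 := abs_le.1 (hacc.2 hcomp)
    have h3 := (S.activeInvariant hr).width_le _ (S.rule h).1 hcomp hC
    have h4 := S.opt_le_of_index_eq hc hr (I := _)
      (by rw [index, if_neg (length_plays_ne_zero hC), if_pos hcomp])
    refine max_le ?_ ?_
    · linarith [h1.2]
    · rw [Market.cellWidth, if_pos hcomp]
      linarith [h2.1]
  · have h4 := S.opt_le_of_index_eq hc hr (I := _)
      (by rw [index, if_neg (length_plays_ne_zero hC), if_neg hcomp])
    refine max_le ?_ ?_
    · linarith [h1.2]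
    · rw [Market.cellWidth, if_neg hcomp]
      linarith

lemma sq_radius (S : Setting M Xc c T select) (hC : C ∈ playedCells h) :
    (plays h C).length * radius c T h C ^ 2 = c * Real.log T := by
  have hL := S.one_le_log
  have hc := S.conf_pos
  have h0 : ((plays h C).length : ℝ) ≠ 0 := by exact_mod_cast length_plays_ne_zero hC
  rw [radius, Real.sq_sqrt (by positivity)]
  field_simp

lemma sq_badness_le (S : Setting M Xc c T select) (hC : Cell.Feasible Xc C ∧ C.Relevant Xc) :
    M.badness Xc C ^ 2 ≤ c * Real.log T := by
  have h1 := M.badness_le S.bounded hC.1 hC.2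
  have h2 := M.badness_nonneg S.fosd S.ties hC.1
  have h3 := S.four_mul_sq_le
  have h4 := S.conf_pos
  have h5 := S.one_le_log
  nlinarith

lemma length_plays_mul_sq_badness_le (S : Setting M Xc c T select) (hr : IsRun Xc select h) :
    Clean M Xc c T h → ∀ C ∈ playedCells h,
      (plays h C).length * M.badness Xc C ^ 2 ≤ 122 * (c * Real.log T) := by
  induction hr with
  | nil => simp [playedCells]
  | @cons h p hr ih =>
    intro hc C hC
    rw [playedCells_cons, Finset.mem_insert] at hC
    by_cases hCB : C = select h
    · subst hCB
      have h1 := S.sq_badness_le (S.select_feasible hr)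
      have h2 : plays (roundAt Xc (select h) p :: h) (select h) =
          roundAt Xc (select h) p :: plays h (select h) := plays_cons_self _ h
      rw [h2, List.length_cons]
      push_cast
      by_cases hpl : select h ∈ playedCells h
      · have h3 := S.badness_le_radius hc.1 hr hpl
        have h4 := S.sq_radius hpl
        have h5 := M.badness_nonneg S.fosd S.ties (S.select_feasible hr).1
        have h6 : M.badness Xc (select h) ^ 2 ≤ (11 * radius c T h (select h)) ^ 2 :=
          pow_le_pow_left₀ h5 h3 2
        have h7 := mul_le_mul_of_nonneg_left h6
          (Nat.cast_nonneg (plays h (select h)).length (α := ℝ))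
        linarith
      · rw [mem_playedCells, not_not] at hpl
        rw [hpl, List.length_nil, Nat.cast_zero]
        have := S.conf_pos
        have := S.one_le_log
        have : 0 ≤ c * Real.log T := by positivity
        linarith
    · rw [plays_cons_of_ne h fun h' => hCB h'.symm]
      exact ih hc.1 C (hC.resolve_left hCB)

/-- A cell is zoomed into only when its virtual width exceeds the confidence radius, and at the
last choice before its regret per round was at most eleven confidence radii. -/
lemma regret_le_of_zoomed (S : Setting M Xc c T select) (hr : IsRun Xc select h)
    {p : Bool × Fin (m + 1)} (hc : Clean M Xc c T (roundAt Xc (select h) p :: h))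
    (hcomp : (select h).Composite Xc)
    (hz : 5 * radius c T (roundAt Xc (select h) p :: h) (select h) <
      estWidth M.value (roundAt Xc (select h) p :: h) (select h)) :
    M.opt Xc - M.cellUtility Xc (select h) ≤ 16 * M.virtualWidth (select h) := by
  set h' := roundAt Xc (select h) p :: h with hh'
  have hmem : select h ∈ playedCells h' := by
    rw [playedCells_cons]
    exact Finset.mem_insert_self _ _
  have h1 := abs_le.1 ((hc.accurate hmem).2 hcomp)
  have hrad : 0 ≤ radius c T h' (select h) := radius_nonneg
  have h2 : M.opt Xc - M.cellUtility Xc (select h) ≤ M.badness Xc (select h) := le_max_left _ _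
  suffices h3 : M.badness Xc (select h) ≤ 16 * radius c T h' (select h) by linarith [h1.2]
  have h4 : plays h' (select h) = roundAt Xc (select h) p :: plays h (select h) :=
    plays_cons_self _ h
  have h5 := S.sq_radius hmem
  rw [h4, List.length_cons] at h5
  push_cast at h5
  by_cases hpl : select h ∈ playedCells h
  · have h6 := S.badness_le_radius hc.1 hr hpl
    have h7 := S.sq_radius hpl
    have h8 : (1 : ℝ) ≤ (plays h (select h)).length := by
      exact_mod_cast Nat.one_le_iff_ne_zero.2 (length_plays_ne_zero hpl)
    refine h6.trans (abs_le_of_sq_le_sq' ?_ (by positivity)).2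
    -- The number of rounds at most doubles, and `2 * 11 ^ 2 ≤ 16 ^ 2`.
    have h9 : radius c T h (select h) ^ 2 ≤ 2 * radius c T h' (select h) ^ 2 := by
      refine le_of_mul_le_mul_left ?_ (zero_lt_one.trans_le h8)
      nlinarith [sq_nonneg (radius c T h' (select h))]
    nlinarith [sq_nonneg (radius c T h' (select h))]
  · rw [mem_playedCells, not_not] at hpl
    rw [hpl, List.length_nil, Nat.cast_zero, zero_add, one_mul] at h5
    have h6 := S.sq_badness_le (S.select_feasible hr)
    rw [← h5] at h6
    have h7 := (abs_le_of_sq_le_sq' h6 hrad).2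
    linarith

lemma hasWideParent_of_active (S : Setting M Xc c T select) (hr : IsRun Xc select h) :
    Clean M Xc c T h → ∀ C ∈ active M.value Xc c T h, HasWideParent M Xc C := by
  induction hr with
  | nil => exact fun _ C hC => Or.inl hC
  | @cons h p hr ih =>
    intro hc C hC
    rw [active] at hC
    split_ifs at hC with hz
    · rcases hC.1 with hC1 | hC1
      · exact ih hc.1 C hC1
      · exact Or.inr ⟨select h, (S.select_feasible hr).1, hz.1, hC1.1,
          S.regret_le_of_zoomed hr hc hz.1 hz.2⟩
    · exact ih hc.1 C hC

lemma hasWideParent_of_played (S : Setting M Xc c T select) (hr : IsRun Xc select h) :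
    Clean M Xc c T h → ∀ C ∈ playedCells h, HasWideParent M Xc C := by
  induction hr with
  | nil => simp [playedCells]
  | @cons h p hr ih =>
    intro hc C hC
    rw [playedCells_cons, Finset.mem_insert] at hC
    rcases hC with rfl | hC
    · exact S.hasWideParent_of_active hr hc.1 _ (S.rule h).1
    · exact ih hc.1 C hC

end Setting
end

/-! ### Counting chosen cells by the width dimension -/

section

open Classical

variable {m : ℕ} {E : Type u} {Θ : Type v} [MeasurableSpace Θ]
variable {M : Market m E Θ} {Xc : Set (Fin m → ℝ)} {c : ℝ} {T : ℕ}
  {select : List (Round m) → Cell m} {h : List (Round m)} {C : Cell m}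

/-- If the numbers of values in `[r, 2r)` grow at most like `r ^ (-d)`, then dyadic summation bounds
the sum of the reciprocals by the contribution of the lowest scale. -/
lemma sum_inv_le_of_card_le {ι : Type*} {F : Finset ι} {w : ι → ℝ} {δ A d : ℝ} (hδ : 0 < δ)
    (hA : 0 ≤ A) (hd : 0 ≤ d) (hw : ∀ i ∈ F, δ ≤ w i)
    (hcard : ∀ r, 0 < r → (((F.filter fun i => r ≤ w i ∧ w i < 2 * r).card : ℕ) : ℝ) ≤
      A * r ^ (-d)) :
    ∑ i ∈ F, 1 / w i ≤ 2 * A * δ ^ (-1 - d) := by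
  have hex : ∀ i, ∃ k : ℕ, i ∈ F → δ * 2 ^ k ≤ w i ∧ w i < 2 * (δ * 2 ^ k) := by
    intro i
    by_cases hi : i ∈ F
    · obtain ⟨k, hk1, hk2⟩ := exists_nat_pow_near ((one_le_div hδ).2 (hw i hi)) one_lt_two
      rw [le_div_iff₀ hδ] at hk1
      rw [div_lt_iff₀ hδ, pow_succ] at hk2
      exact ⟨k, fun _ => ⟨by linarith, by linarith⟩⟩
    · exact ⟨0, fun h => absurd h hi⟩
  choose κ hκ using hex
  have hfib : ∀ k ∈ F.image κ, ∑ i ∈ F.filter (fun i => κ i = k), 1 / w i ≤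
      A * δ ^ (-1 - d) * (1 / 2) ^ k := by
    intro k _
    have hr : 0 < δ * 2 ^ k := by positivity
    calc ∑ i ∈ F.filter (fun i => κ i = k), 1 / w i
        ≤ ∑ i ∈ F.filter (fun i => κ i = k), 1 / (δ * 2 ^ k) := by
          refine Finset.sum_le_sum fun i hi => one_div_le_one_div_of_le hr ?_
          obtain ⟨hiF, rfl⟩ := Finset.mem_filter.1 hi
          exact (hκ i hiF).1
      _ = ((F.filter (fun i => κ i = k)).card : ℝ) * (1 / (δ * 2 ^ k)) := by
          rw [Finset.sum_const, nsmul_eq_mul]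
      _ ≤ (A * δ ^ (-d)) * (1 / (δ * 2 ^ k)) := by
          refine mul_le_mul_of_nonneg_right (le_trans ?_ ((hcard _ hr).trans ?_)) (by positivity)
          · refine Nat.cast_le.2 (Finset.card_le_card fun i hi => ?_)
            obtain ⟨hiF, rfl⟩ := Finset.mem_filter.1 hi
            exact Finset.mem_filter.2 ⟨hiF, hκ i hiF⟩
          · refine mul_le_mul_of_nonneg_left ?_ hA
            refine Real.rpow_le_rpow_of_nonpos hδ ?_ (by linarith)
            exact le_mul_of_one_le_right hδ.le (one_le_pow₀ one_le_two)
      _ = A * δ ^ (-1 - d) * (1 / 2) ^ k := by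
          have : δ ^ (-1 - d) = δ ^ (-d) * δ⁻¹ := by
            rw [← Real.rpow_neg_one, ← Real.rpow_add hδ]
            congr 1
            ring
          rw [this, one_div_pow]
          field_simp
  rw [← Finset.sum_fiberwise_of_maps_to (fun i hi => Finset.mem_image_of_mem κ hi)]
  calc _ ≤ ∑ k ∈ F.image κ, A * δ ^ (-1 - d) * (1 / 2) ^ k := Finset.sum_le_sum hfib
    _ = A * δ ^ (-1 - d) * ∑ k ∈ F.image κ, (1 / 2 : ℝ) ^ k := by rw [Finset.mul_sum]
    _ ≤ A * δ ^ (-1 - d) * 2 := by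
        refine mul_le_mul_of_nonneg_left ?_ (by positivity)
        exact (summable_geometric_two.sum_le_tsum _ fun k _ => by positivity).trans_eq
          tsum_geometric_two
    _ = 2 * A * δ ^ (-1 - d) := by ring

lemma sum_map_cell (h : List (Round m)) (f : Cell m → ℝ) :
    (h.map fun r => f r.cell).sum = ∑ C ∈ playedCells h, (plays h C).length * f C := by
  have h1 : (h.map fun r => f r.cell) = (h.map Round.cell).map f := by simp
  rw [h1, Finset.sum_list_map_count]
  refine Finset.sum_congr rfl fun C _ => ?_
  rw [nsmul_eq_mul]
  congr 2
  rw [List.count, List.countP_map, List.countP_eq_length_filter]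
  rfl

namespace Setting

/-- The cell that a chosen cell is charged to: its parent, or the root itself. -/
lemma exists_wide (S : Setting M Xc c T select) (hF : Cell.Feasible Xc C) (hR : C.Relevant Xc)
    (hP : HasWideParent M Xc C) (hb : 0 < M.badness Xc C) :
    ∃ D, Cell.Feasible Xc D ∧ D.Composite Xc ∧ C ∈ insert D D.quadrants ∧
      C.toSet ⊆ D.toSet ∧ M.badness Xc C ≤ 17 * M.virtualWidth D := by
  rcases hP with rfl | ⟨D, hDF, hDc, hCD, hD⟩
  · have hroot : ∀ x ∈ Xc, x ∈ (Cell.root m).toSet ∩ Xc := fun x hx =>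
      ⟨Cell.weaklyBounded_eq_root m ▸ boundedMonotone_subset (S.bounded hx), hx⟩
    by_cases hcomp : (Cell.root m).Composite Xc
    · refine ⟨_, hF, hcomp, Or.inl rfl, subset_rfl, ?_⟩
      have h0 := M.virtualWidth_nonneg S.fosd S.ties hF
      have h1 := M.minUtility_le_cellUtility S.fosd S.ties hF hF hR subset_rfl
      have h2 : M.opt Xc ≤ M.minUtility (Cell.root m) + M.virtualWidth (Cell.root m) := by
        refine csSup_le (S.nonempty.image _) ?_
        rintro _ ⟨x, hx, rfl⟩
        exact M.le_minUtility_add S.fosd S.ties hF (hroot x hx).1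
      refine max_le (by linarith) ?_
      rw [Market.cellWidth, if_pos hcomp]
      linarith
    · -- With a single candidate contract the badness of the root vanishes.
      exfalso
      have h2 : M.opt Xc ≤ M.cellUtility Xc (Cell.root m) := by
        refine csSup_le (S.nonempty.image _) ?_
        rintro _ ⟨x, hx, rfl⟩
        exact (M.cellUtility_atomic hR hcomp (hroot x hx)).ge
      have h3 : M.badness Xc (Cell.root m) ≤ 0 := by
        refine max_le (by linarith) ?_
        rw [Market.cellWidth, if_neg hcomp]
      linarith
  · have hsub := Cell.quadrants_toSet_subset hDF.bounds.1.le hCD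
    refine ⟨D, hDF, hDc, Or.inr hCD, hsub, ?_⟩
    have h0 := M.virtualWidth_nonneg S.fosd S.ties hDF
    have h1 := M.minUtility_le_cellUtility S.fosd S.ties hDF hF hR hsub
    have h2 := M.cellUtility_le S.fosd S.ties hDF hDc.relevant
    refine max_le (by linarith) ?_
    unfold Market.cellWidth
    split_ifs
    · linarith [M.virtualWidth_quadrant_le S.fosd S.ties hDF hF hCD]
    · linarith

/-- Each cell of badness in `[r, 2r)` is charged to a composite cell of virtual width at least
`r / 17` that contains a candidate of regret at most `4 * r`. -/
lemma card_le_of_wideCount_le (S : Setting M Xc c T select) {r A : ℝ} (hr : 0 < r) (hA : 0 ≤ A)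
    (hN : (M.wideCount Xc (4 * r * (1 / 68)) (M.nearOptimal Xc (4 * r)) : ℝ≥0∞) ≤
      ENNReal.ofReal A) (F : Finset (Cell m))
    (hF : ∀ C ∈ F, (Cell.Feasible Xc C ∧ C.Relevant Xc) ∧ HasWideParent M Xc C ∧
      r ≤ M.badness Xc C ∧ M.badness Xc C < 2 * r) :
    (F.card : ℝ) ≤ (2 ^ m + 1) * A := by
  set W : Set (Cell m) := {D | Cell.Feasible Xc D ∧ D.Composite Xc ∧
    4 * r * (1 / 68) ≤ M.virtualWidth D ∧ (D.toSet ∩ M.nearOptimal Xc (4 * r)).Nonempty} with hW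
  have hN' : (W.encard : ℝ≥0∞) ≤ ENNReal.ofReal A := hN
  have hWfin : W.Finite := by
    rw [← Set.encard_ne_top_iff]
    intro htop
    rw [htop] at hN'
    simp at hN'
  have hq : ∀ D : Cell m, D.quadrants.Finite := fun D => by
    unfold Cell.quadrants
    exact Set.finite_range _
  have hWcard : (hWfin.toFinset.card : ℝ) ≤ A := by
    rw [hWfin.encard_eq_coe_toFinset_card] at hN'
    have h1 := ENNReal.toReal_mono ENNReal.ofReal_ne_top hN'
    rw [ENNReal.toReal_ofReal hA] at h1
    simpa using h1
  have hsub : F ⊆ hWfin.toFinset.biUnion fun D => insert D (hq D).toFinset := by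
    intro C hC
    obtain ⟨⟨hCF, hCR⟩, hP, hb1, hb2⟩ := hF C hC
    obtain ⟨D, hDF, hDc, hCD, hsub, hbad⟩ := S.exists_wide hCF hCR hP (hr.trans_le hb1)
    rw [Finset.mem_biUnion]
    refine ⟨D, ?_, by simpa using hCD⟩
    rw [Set.Finite.mem_toFinset]
    refine ⟨hDF, hDc, by linarith, ?_⟩
    obtain ⟨x, hx⟩ := hCR
    refine ⟨x, hsub hx.1, hx.2, ?_⟩
    have h1 := abs_le.1 (M.abs_utility_sub_cellUtility_le S.fosd S.ties hCF hx)
    have h2 : M.opt Xc - M.cellUtility Xc C ≤ M.badness Xc C := le_max_left _ _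
    have h3 : M.cellWidth Xc C ≤ M.badness Xc C := le_max_right _ _
    linarith [h1.1]
  have hcard : F.card ≤ hWfin.toFinset.card * (2 ^ m + 1) := by
    refine (Finset.card_le_card hsub).trans (Finset.card_biUnion_le_card_mul _ _ _ fun D _ => ?_)
    refine (Finset.card_insert_le _ _).trans (Nat.add_le_add_right ?_ 1)
    have h1 := Cell.quadrants_encard_le D
    rw [(hq D).encard_eq_coe_toFinset_card] at h1
    exact_mod_cast h1
  calc (F.card : ℝ) ≤ hWfin.toFinset.card * (2 ^ m + 1) := by exact_mod_cast hcard
    _ ≤ A * (2 ^ m + 1) := mul_le_mul_of_nonneg_right hWcard (by positivity)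
    _ = _ := by ring

/-- In a clean history, the chosen cells of badness below `δ` cost at most `δ` per round, and any
other cell costs of the order of the inverse of its badness. -/
lemma sum_regret_le (S : Setting M Xc c T select) (hr : IsRun Xc select h)
    (hc : Clean M Xc c T h) {α d δ : ℝ} (hα : 0 ≤ α) (hd : 0 ≤ d) (hδ : 0 < δ)
    (hN : ∀ ε : ℝ, 0 < ε → (M.wideCount Xc (ε * (1 / 68)) (M.nearOptimal Xc ε) : ℝ≥0∞) ≤
      ENNReal.ofReal (α * ε ^ (-d))) :
    (h.map fun r => M.opt Xc - M.cellUtility Xc r.cell).sum ≤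
      δ * h.length + 244 * c * (2 ^ m + 1) * (α * Real.log T) * δ ^ (-1 - d) := by
  have hL := S.one_le_log
  have hcpos := S.conf_pos
  have hplay := S.length_plays_mul_sq_badness_le hr hc
  set F := (playedCells h).filter fun C => δ ≤ M.badness Xc C with hFdef
  have hsum : ∑ C ∈ F, 1 / M.badness Xc C ≤ 2 * ((2 ^ m + 1) * α) * δ ^ (-1 - d) := by
    refine sum_inv_le_of_card_le hδ (by positivity) hd (fun C hC => (Finset.mem_filter.1 hC).2)
      fun r hr0 => ?_
    refine (S.card_le_of_wideCount_le (A := α * (4 * r) ^ (-d)) hr0 (by positivity)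
      (hN (4 * r) (by positivity)) _ fun C hC => ?_).trans ?_
    · obtain ⟨hC1, hC2⟩ := Finset.mem_filter.1 hC
      have hC3 := (Finset.mem_filter.1 hC1).1
      exact ⟨S.feasible_of_mem_playedCells hr hC3, S.hasWideParent_of_played hr hc C hC3, hC2⟩
    · rw [mul_assoc]
      refine mul_le_mul_of_nonneg_left (mul_le_mul_of_nonneg_left ?_ hα) (by positivity)
      exact Real.rpow_le_rpow_of_nonpos hr0 (by linarith) (by linarith)
  have hterm : ∀ C ∈ playedCells h,
      (plays h C).length * (M.opt Xc - M.cellUtility Xc C) ≤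
        δ * (plays h C).length + if δ ≤ M.badness Xc C then
          122 * (c * Real.log T) * (1 / M.badness Xc C) else 0 := by
    intro C hC
    have h1 : M.opt Xc - M.cellUtility Xc C ≤ M.badness Xc C := le_max_left _ _
    have h2 := mul_le_mul_of_nonneg_left h1 (Nat.cast_nonneg (plays h C).length (α := ℝ))
    split_ifs with hbig
    · have hb : 0 < M.badness Xc C := hδ.trans_le hbig
      have h3 : (plays h C).length * M.badness Xc C ≤
          122 * (c * Real.log T) * (1 / M.badness Xc C) := by
        rw [mul_one_div, le_div_iff₀ hb, mul_assoc, ← sq]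
        exact hplay C hC
      have : 0 ≤ δ * ((plays h C).length : ℝ) := by positivity
      linarith
    · have h3 := mul_le_mul_of_nonneg_left (not_le.1 hbig).le
        (Nat.cast_nonneg (plays h C).length (α := ℝ))
      linarith
  have hlen : ∑ C ∈ playedCells h, ((plays h C).length : ℝ) = h.length := by
    have := sum_map_cell h fun _ => 1
    simpa using this.symm
  rw [sum_map_cell h fun C => M.opt Xc - M.cellUtility Xc C]
  calc _ ≤ ∑ C ∈ playedCells h, (δ * (plays h C).length + if δ ≤ M.badness Xc C then
          122 * (c * Real.log T) * (1 / M.badness Xc C) else 0) := Finset.sum_le_sum hterm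
    _ = δ * h.length + 122 * (c * Real.log T) * ∑ C ∈ F, 1 / M.badness Xc C := by
        rw [Finset.sum_add_distrib, ← Finset.mul_sum, hlen, ← Finset.sum_filter, Finset.mul_sum]
    _ ≤ δ * h.length + 122 * (c * Real.log T) * (2 * ((2 ^ m + 1) * α) * δ ^ (-1 - d)) := by
        have := mul_le_mul_of_nonneg_left hsum
          (show 0 ≤ 122 * (c * Real.log T) by positivity)
        linarith
    _ = _ := by ring

/-! ### The regret bound -/

lemma sum_regret_le_trivial (S : Setting M Xc c T select) (hr : IsRun Xc select h) :
    (h.map fun r => M.opt Xc - M.cellUtility Xc r.cell).sum ≤ h.length * (m + 1) := by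
  have := List.sum_le_card_nsmul (h.map fun r => M.opt Xc - M.cellUtility Xc r.cell)
    ((m : ℝ) + 1) fun x hx => by
      obtain ⟨r, hmem, rfl⟩ := List.mem_map.1 hx
      obtain ⟨hF, hR⟩ := (S.round_of_mem hr r hmem).1
      exact (le_max_left _ _).trans (M.badness_le S.bounded hF hR)
  simpa [mul_add] using this

lemma regret_le_trivial (S : Setting M Xc c T select) : M.regret Xc select T ≤ T * (m + 1) := by
  rw [M.regret_eq]
  refine (M.histMean_mono fun h hr hl => ?_).trans (M.histMean_const T _).le
  rw [← hl]
  exact S.sum_regret_le_trivial hr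

lemma regret_le (S : Setting M Xc c T select) {α d : ℝ} (hα : 0 ≤ α) (hd : 0 ≤ d)
    (hN : ∀ ε : ℝ, 0 < ε → (M.wideCount Xc (ε * (1 / 68)) (M.nearOptimal Xc ε) : ℝ≥0∞) ≤
      ENNReal.ofReal (α * ε ^ (-d))) :
    M.regret Xc select T ≤ (1 + 244 * c * (2 ^ m + 1) + 8 * (m + 1)) *
      max 1 (α * Real.log T) * (T : ℝ) ^ ((1 + d) / (2 + d)) := by
  have hT0 : (0 : ℝ) < T := by exact_mod_cast zero_lt_one.trans S.one_lt
  have hT1 : (1 : ℝ) ≤ T := by exact_mod_cast S.one_lt.le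
  have hcpos := S.conf_pos
  -- The choice of `δ` balances the two terms of the bound for clean histories.
  set δ : ℝ := (T : ℝ) ^ (-1 / (2 + d)) with hδ
  set P : ℝ := (T : ℝ) ^ ((1 + d) / (2 + d)) with hP
  have h2d : (2 + d) ≠ 0 := by positivity
  have e1 : δ * T = P := by
    rw [hδ, hP]
    nth_rewrite 2 [← Real.rpow_one (T : ℝ)]
    rw [← Real.rpow_add hT0]
    congr 1
    field_simp
    ring
  have e2 : δ ^ (-1 - d) = P := by
    rw [hδ, hP, ← Real.rpow_mul hT0.le]
    congr 1
    field_simp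
    ring
  set B : ℝ := P + 244 * c * (2 ^ m + 1) * (α * Real.log T) * P with hB
  have hP1 : 1 ≤ P := Real.one_le_rpow hT1 (by positivity)
  have hL := S.one_le_log
  have hB0 : 0 ≤ B := by positivity
  have h1 : M.regret Xc select T ≤ B + T * (m + 1) *
      M.histProb Xc select T (fun h => ¬ Clean M Xc c T h) := by
    rw [M.regret_eq, Market.histProb, ← M.histMean_const_mul,
      ← M.histMean_const (Xc := Xc) (select := select) T B, ← M.histMean_add]
    refine M.histMean_mono fun h hr hl => ?_
    by_cases hc : Clean M Xc c T h
    · have h2 := S.sum_regret_le hr hc hα hd (show 0 < δ by positivity) hN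
      rw [hl, e1, e2] at h2
      rw [indicator_of_not (not_not.2 hc), mul_zero, add_zero]
      exact h2
    · have h2 := S.sum_regret_le_trivial hr
      rw [hl] at h2
      rw [indicator_of hc, mul_one]
      linarith
  have h2 := S.histProb_not_clean_le le_rfl
  have h3 : (T : ℝ) * (m + 1) * M.histProb Xc select T (fun h => ¬ Clean M Xc c T h) ≤
      8 * (m + 1) := by
    refine (mul_le_mul_of_nonneg_left h2 (by positivity)).trans (le_of_eq ?_)
    field_simp
  set X := max 1 (α * Real.log T) with hX
  have hX1 : 1 ≤ X := le_max_left _ _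
  have hX2 : α * Real.log T ≤ X := le_max_right _ _
  have hXP : 1 ≤ X * P := one_le_mul_of_one_le_of_one_le hX1 hP1
  have h4 : P ≤ X * P := le_mul_of_one_le_left (by positivity) hX1
  have h5 : 244 * c * (2 ^ m + 1) * (α * Real.log T * P) ≤ 244 * c * (2 ^ m + 1) * (X * P) :=
    mul_le_mul_of_nonneg_left (mul_le_mul_of_nonneg_right hX2 (by positivity)) (by positivity)
  have h6 : 8 * ((m : ℝ) + 1) * 1 ≤ 8 * (m + 1) * (X * P) :=
    mul_le_mul_of_nonneg_left hXP (by positivity)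
  calc M.regret Xc select T ≤ B + 8 * (m + 1) := by linarith
    _ ≤ X * P + 244 * c * (2 ^ m + 1) * (X * P) + 8 * (m + 1) * (X * P) := by
        rw [hB]
        linarith
    _ = _ := by ring

end Setting

/-- The infimum in the definition of the width dimension is attained if it is finite. -/
lemma wideCount_le_of_widthDim_ne_top {β α : ℝ} (hd : M.widthDim Xc β α ≠ ⊤) {ε : ℝ}
    (hε : 0 < ε) : (M.wideCount Xc (ε * β) (M.nearOptimal Xc ε) : ℝ≥0∞) ≤
      ENNReal.ofReal (α * ε ^ (-(M.widthDim Xc β α).toReal)) := by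
  set D : Set ℝ≥0 := {d : ℝ≥0 | ∀ ε : ℝ, 0 < ε →
    (M.wideCount Xc (ε * β) (M.nearOptimal Xc ε) : ℝ≥0∞) ≤
      ENNReal.ofReal (α * ε ^ (-(d : ℝ)))} with hD
  have hdim : M.widthDim Xc β α = ⨅ d ∈ D, (d : ℝ≥0∞) := rfl
  have hne : D.Nonempty := by
    by_contra hemp
    rw [Set.not_nonempty_iff_eq_empty] at hemp
    rw [hdim, hemp] at hd
    simp at hd
  have hclosed : IsClosed D := by
    simp only [hD, Set.ofPred_forall]
    refine isClosed_iInter fun ε => isClosed_iInter fun hε => isClosed_le continuous_const ?_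
    exact ENNReal.continuous_ofReal.comp (continuous_const.mul
      ((Real.continuous_const_rpow hε.ne').comp NNReal.continuous_coe.neg))
  have hmem : sInf D ∈ D := hclosed.csInf_mem hne (OrderBot.bddBelow D)
  rw [hdim, ← ENNReal.coe_sInf hne]
  exact hmem ε hε

lemma regret_eq_zero_of_no_outcome {M : Market 0 E Θ} {Xc : Set (Fin 0 → ℝ)}
    (hne : Xc.Nonempty) (select : List (Round 0) → Cell 0) (T : ℕ) :
    M.regret Xc select T = 0 := by
  have hU : ∀ x, M.utility x = 0 := fun x => by
    simp [Market.utility, Market.expValue, Market.expPay, pay, M.value_zero]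
  have hopt : M.opt Xc = 0 := by
    have : M.utility '' Xc = {0} := by
      ext y
      constructor
      · rintro ⟨x, _, rfl⟩
        exact hU x
      · rintro rfl
        exact ⟨hne.some, hne.some_mem, hU _⟩
    rw [Market.opt, this, csSup_singleton]
  rw [M.regret_eq]
  simp only [hopt, Market.cellUtility, hU]
  simpa using M.histMean_const (Xc := Xc) (select := select) T 0

end

end AgnosticZooming

end

theorem corollary1 :
    ∃ β : ℝ, 0 < β ∧
      ∀ (m : ℕ) (c : ℝ), 16 * (m : ℝ) ^ 2 ≤ c →
        ∃ K : ℝ, 0 < K ∧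
          ∀ (E : Type u) (Θ : Type v) [MeasurableSpace Θ] (M : AgnosticZooming.Market m E Θ)
            (Xc : Set (Fin m → ℝ)) (T : ℕ) (select : List (AgnosticZooming.Round m) →
              AgnosticZooming.Cell m) (α : ℝ),
            M.FOSD → M.ConsistentTies →
            Xc ⊆ AgnosticZooming.boundedMonotone m → Xc.Nonempty →
            max (2 ^ m + 1) 18 ≤ T →
            AgnosticZooming.IsSelectionRule M.value Xc c T select →
            0 < α →
            M.regret Xc select T ≤
              K * max 1 (α * Real.log T) *
                (T : ℝ) ^ AgnosticZooming.regretExponent (M.widthDim Xc β α) := by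
  refine ⟨1 / 68, by norm_num, fun m c hc => ?_⟩
  have hc0 : 0 ≤ c := le_trans (by positivity) hc
  refine ⟨1 + 244 * c * (2 ^ m + 1) + 8 * (m + 1), by positivity, ?_⟩
  intro E Θ _ M Xc T select α hF hTies hX hne hT hrule hα
  rcases Nat.eq_zero_or_pos m with rfl | hm
  · rw [AgnosticZooming.regret_eq_zero_of_no_outcome hne]
    have : (0 : ℝ) ≤ max 1 (α * Real.log T) := le_max_of_le_left zero_le_one
    positivity
  have S : AgnosticZooming.Setting M Xc c T select :=
    ⟨hF, hTies, hX, hne, hrule, hm, hc, (le_max_right _ _).trans hT⟩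
  by_cases hd : M.widthDim Xc (1 / 68) α = ⊤
  · rw [hd, AgnosticZooming.regretExponent, if_pos rfl, Real.rpow_one]
    refine S.regret_le_trivial.trans ?_
    rw [mul_comm]
    refine mul_le_mul_of_nonneg_right ?_ (Nat.cast_nonneg T)
    have h1 : (1 : ℝ) ≤ max 1 (α * Real.log T) := le_max_left _ _
    have h2 : (0 : ℝ) ≤ 244 * c * (2 ^ m + 1) := by positivity
    have h3 : (0 : ℝ) ≤ m := Nat.cast_nonneg m
    refine le_trans ?_ (le_mul_of_one_le_right (by positivity) h1)
    linarith
  · rw [AgnosticZooming.regretExponent, if_neg hd]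
    exact S.regret_le hα.le ENNReal.toReal_nonneg fun ε hε =>
      AgnosticZooming.wideCount_le_of_widthDim_ne_top hd hε
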